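/- Let $M$ be a smooth ($C^\infty$, Hausdorff, second countable) manifold of real dimension $2N$, let $\mathfrak M$ be a separable complex Hilbert space with scalar product $\langle\cdot|\cdot\rangle$ antilinear in the first argument, and let $\mathcal K:M\to\mathbb{CP}(\mathfrak M)$ be a smooth map with linearly dense image; smooth means that $M$ is covered by open sets $\Omega_\alpha$ with smooth maps $K_\alpha:\Omega_\alpha\to\mathfrak M\setminus\{0\}$, $[K_\alpha(m)]=\mathcal K(m)$. Let $\mathbb L\to M$ be the pull-back by $\mathcal K$ of the tautological line bundle, $s_\alpha=K_\alpha$ its local frames, $\nabla s_\alpha=\Theta_\alpha\otimes s_\alpha$ with $\Theta_\alpha=\frac{\langle K_\alpha|dK_\alpha\rangle}{\langle K_\alpha|K_\alpha\rangle}$ the pull-back of the Fubini–Study connection, and $\omega=i\,\mathrm{curv}\,\nabla=i\,d\Theta_\alpha=\mathcal K^*\omega_{FS}$. Let $\overline{\mathbb L}^*$ be the dual of the complex conjugate bundle, with the induced connection $\overline\nabla^*$ (for a section $\psi$ and a complex vector field $X$, $(\overline\nabla^*_X\psi)(\overline s_\alpha)=X(\psi(\overline s_\alpha))-\overline{\Theta_\alpha(\overline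 X)}\,\psi(\overline s_\alpha)$), and let $I(v)$, $v\in\mathfrak M$, be its section with $I(v)(\overline s_\alpha)=\langle K_\alpha|v\rangle$. Let $P\subset T^{\mathbb C}M$ be the complex distribution spanned by the smooth complex vector fields $X$ with $\overline\nabla^*_X I(v)=0$ for all $v\in\mathfrak M$, and let $\mathcal O_{\mathcal K}$ be the algebra of smooth functions $\lambda:M\to\mathbb C$ with $\lambda I(\mathfrak M)\subset I(\mathfrak M)$. Assume that $\mathcal K$ is a coherent state map, i.e. a) $\omega$ is non-degenerate (symplectic); b) $\dim_{\mathbb C}P_m=N$ for every $m\in M$; c) every $m\in M$ has an open neighbourhood $\Omega$ and functions $\lambda_1,\dots,\lambda_N\in\mathcal O_{\mathcal K}$ whose differentials $d\lambda_1,\dots,d\lambda_N$ are linearly independent over $\mathbb C$ at every point of $\Omega$. Then: i) $M$ is a Kähler manifold and $\mathcal K$ is a Kähler immersion. That is, there are a holomorphic atlas on $M$ compatible with its smooth structure, with complex structure $J$, and a smooth Riemannian metric $g$ on $M$ with $g(Ju,Jv)=g(u,v)$, whose fundamental form $g(u,Jv)$ equals $\omega$ and is closed, such that $\mathcal K$ is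 a holomorphic immersion with $g=\mathcal K^*g_{FS}$ and $\omega=\mathcal K^*\omega_{FS}$. Here $T_\ell\mathbb{CP}(\mathfrak M)=\mathrm{Hom}(\ell,\ell^\perp)$ and, for $A,B\in\mathrm{Hom}(\ell,\ell^\perp)$ and $0\ne v\in\ell$, $\omega_{FS}(A,B)=i\,\frac{\langle Av|Bv\rangle-\langle Bv|Av\rangle}{\langle v|v\rangle}$ and $g_{FS}(A,B)=2\,\mathrm{Re}\frac{\langle Av|Bv\rangle}{\langle v|v\rangle}$. Moreover $P_m=\{u-iJu:\ u\in T_mM\}$ for every $m\in M$. ii) $P$ is a Kähler polarization of $(M,\omega)$: a smooth complex distribution of rank $N$ with $\omega|_{P\times P}=0$, involutive, with $P\cap\overline P=0$, and with $i\,\omega(X,\overline X)>0$ for all $0\neq X\in P$. Every $\lambda\in\mathcal O_{\mathcal K}$ has a unique smooth complex Hamiltonian vector field $X_\lambda$, $\omega(X_\lambda,\cdot)=d\lambda$, and $P_m=\mathrm{span}_{\mathbb C}\{X_\lambda(m):\lambda\in\mathcal O_{\mathcal K}\}$ for every $m\in M$. -/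

import Mathlib

open Set Module
open scoped Manifold ContDiff Topology TensorProduct InnerProductSpace LinearAlgebra.Projectivization

noncomputable section

namespace CoherentState

/-! ## Calculus on a manifold modelled on a real normed space `E` -/

section Calculus

variable {E : Type*} [NormedAddCommGroup E] [NormedSpace ℝ E]
  {M : Type*} [TopologicalSpace M] [ChartedSpace E M]
  {F : Type*} [NormedAddCommGroup F] [NormedSpace ℝ F]

/-- The differential at `x` of a function `f : M → F` with values in a normed space. -/
def vderiv (f : M → F) (x : M) : TangentSpace 𝓘(ℝ, E) x →L[ℝ] F :=
  mfderiv 𝓘(ℝ, E) 𝓘(ℝ, F) f x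

/-- A differential form of degree `n` on `M` with values in `F`. -/
abbrev Form (E M F : Type*) [NormedAddCommGroup E] [NormedSpace ℝ E]
    [TopologicalSpace M] [ChartedSpace E M] [NormedAddCommGroup F] [NormedSpace ℝ F] (n : ℕ) :=
  (x : M) → TangentSpace 𝓘(ℝ, E) x [⋀^Fin n]→L[ℝ] F

/-- The representative of a differential form in the preferred chart at `x₀`: its pullback
under the inverse of the chart. -/
def Form.inChart {n : ℕ} (θ : Form E M F n) (x₀ : M) (y : E) : E [⋀^Fin n]→L[ℝ] F :=
  (θ ((extChartAt 𝓘(ℝ, E) x₀).symm y)).compContinuousLinearMap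
    (mfderiv 𝓘(ℝ, E) 𝓘(ℝ, E) (extChartAt 𝓘(ℝ, E) x₀).symm y :
      E →L[ℝ] TangentSpace 𝓘(ℝ, E) ((extChartAt 𝓘(ℝ, E) x₀).symm y))

/-- The exterior derivative of a differential form on `M`, computed at `x` in the preferred
chart at `x`. With the normalisation of Mathlib,
`dθ(u, v) = u(θ(v)) - v(θ(u)) - θ([u, v])` in degree one. -/
def Form.d {n : ℕ} (θ : Form E M F n) : Form E M F (n + 1) := fun x =>
  (extDeriv (θ.inChart x) (extChartAt 𝓘(ℝ, E) x x)).compContinuousLinearMap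
    (mfderiv 𝓘(ℝ, E) 𝓘(ℝ, E) (extChartAt 𝓘(ℝ, E) x) x :
      TangentSpace 𝓘(ℝ, E) x →L[ℝ] E)

end Calculus

/-! ## The complexified tangent bundle -/

section Complexified

variable {V : Type*} [AddCommGroup V] [Module ℝ V]

/-- The real part `u` of `u + i v` in the complexification `ℂ ⊗ V`. -/
def reT : ℂ ⊗[ℝ] V →ₗ[ℝ] V := (TensorProduct.lid ℝ V).toLinearMap ∘ₗ Complex.reLm.rTensor V

/-- The imaginary part `v` of `u + i v` in the complexification `ℂ ⊗ V`. -/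
def imT : ℂ ⊗[ℝ] V →ₗ[ℝ] V := (TensorProduct.lid ℝ V).toLinearMap ∘ₗ Complex.imLm.rTensor V

/-- The vector `u + i v` of the complexification `ℂ ⊗ V`. -/
def mkT (u v : V) : ℂ ⊗[ℝ] V := (1 : ℂ) ⊗ₜ[ℝ] u + Complex.I ⊗ₜ[ℝ] v

/-- Complex conjugation `u + i v ↦ u - i v`. -/
def conjT (X : ℂ ⊗[ℝ] V) : ℂ ⊗[ℝ] V := mkT (reT X) (-imT X)

@[simp] lemma reT_mkT (u v : V) : reT (mkT u v) = u := by simp [reT, mkT]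

@[simp] lemma imT_mkT (u v : V) : imT (mkT u v) = v := by simp [imT, mkT]

lemma mkT_reT_imT (X : ℂ ⊗[ℝ] V) : mkT (reT X) (imT X) = X := by
  induction X using TensorProduct.induction_on with
  | zero => simp [mkT]
  | tmul z v =>
    have h : z = z.re • (1 : ℂ) + z.im • Complex.I := by
      simp [Complex.re_add_im]
    conv_rhs => rw [h, TensorProduct.add_tmul, TensorProduct.smul_tmul, TensorProduct.smul_tmul]
    simp [mkT, reT, imT]
  | add X Y hX hY =>
    conv_rhs => rw [← hX, ← hY]
    simp only [mkT, map_add, TensorProduct.tmul_add]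
    abel

variable [TopologicalSpace V] {F : Type*} [NormedAddCommGroup F] [NormedSpace ℂ F]

/-- The complex linear extension to `ℂ ⊗ V` of a real linear map `V → F`. -/
def extC (L : V →L[ℝ] F) (X : ℂ ⊗[ℝ] V) : F := L (reT X) + Complex.I • L (imT X)

/-- The complex bilinear extension to `ℂ ⊗ V` of a complex valued alternating 2-form on `V`. -/
def extC₂ (β : V [⋀^Fin 2]→L[ℝ] ℂ) (X Y : ℂ ⊗[ℝ] V) : ℂ :=
  β ![reT X, reT Y] - β ![imT X, imT Y]
    + Complex.I * (β ![reT X, imT Y] + β ![imT X, reT Y])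

end Complexified

section VectorFields

variable (E : Type*) [NormedAddCommGroup E] [NormedSpace ℝ E]
  {M : Type*} [TopologicalSpace M] [ChartedSpace E M]

/-- The fibre at `x` of the complexified tangent bundle of `M`. -/
abbrev CTangent (x : M) := ℂ ⊗[ℝ] TangentSpace 𝓘(ℝ, E) x

variable {E}

/-- The Lie bracket of complex vector fields (complex bilinear extension of the real one). -/
def bracket (X Y : (x : M) → CTangent E x) (x : M) : CTangent E x :=
  mkT
    (VectorField.mlieBracket 𝓘(ℝ, E) (fun y => reT (X y)) (fun y => reT (Y y)) x
      - VectorField.mlieBracket 𝓘(ℝ, E) (fun y => imT (X y)) (fun y => imT (Y y)) x)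
    (VectorField.mlieBracket 𝓘(ℝ, E) (fun y => reT (X y)) (fun y => imT (Y y)) x
      + VectorField.mlieBracket 𝓘(ℝ, E) (fun y => imT (X y)) (fun y => reT (Y y)) x)

variable [IsManifold 𝓘(ℝ, E) ∞ M]

/-- Smooth complex vector fields: the real and the imaginary part are smooth. -/
def SmoothField (X : (x : M) → CTangent E x) : Prop :=
  ContMDiff 𝓘(ℝ, E) 𝓘(ℝ, E).tangent ∞
      (fun x => (⟨x, reT (X x)⟩ : TangentBundle 𝓘(ℝ, E) M)) ∧
    ContMDiff 𝓘(ℝ, E) 𝓘(ℝ, E).tangent ∞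
      (fun x => (⟨x, imT (X x)⟩ : TangentBundle 𝓘(ℝ, E) M))

/-- Smooth sections of a complex distribution. -/
def IsSection (P : (x : M) → Submodule ℂ (CTangent E x)) (X : (x : M) → CTangent E x) : Prop :=
  SmoothField X ∧ ∀ x, X x ∈ P x

/-- A Kähler polarization of `(M, σ)`, where `dim M = 2 N`: a smooth complex distribution of rank
`N` which is Lagrangian, involutive, transversal to its conjugate, and positive. -/
structure IsKahlerPolarization (N : ℕ) (σ : Form E M ℂ 2)
    (P : (x : M) → Submodule ℂ (CTangent E x)) : Prop where
  rank_eq : ∀ x, finrank ℂ (P x) = N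
  smooth : ∀ x, ∀ Z ∈ P x, ∃ X, IsSection P X ∧ X x = Z
  isotropic : ∀ x, ∀ Z ∈ P x, ∀ W ∈ P x, extC₂ (σ x) Z W = 0
  involutive : ∀ X Y, IsSection P X → IsSection P Y → IsSection P (bracket X Y)
  transversal : ∀ x, ∀ Z ∈ P x, conjT Z ∈ P x → Z = 0
  positive : ∀ x, ∀ Z ∈ P x, Z ≠ 0 →
    0 < (Complex.I * extC₂ (σ x) Z (conjT Z)).re ∧
      (Complex.I * extC₂ (σ x) Z (conjT Z)).im = 0

/-- `X` is the Hamiltonian vector field of `l`, i.e. `X ⌟ σ = dl`. -/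
def IsHamiltonian (σ : Form E M ℂ 2) (l : M → ℂ) (X : (x : M) → CTangent E x) : Prop :=
  SmoothField X ∧ ∀ x, ∀ Z : CTangent E x, extC₂ (σ x) (X x) Z = extC (vderiv l x) Z

end VectorFields

/-! ## Kähler manifolds -/

/-- A Kähler structure of complex dimension `N` on the smooth real manifold `M`: a holomorphic
atlas compatible with the smooth structure, with its complex structure tensor `J`, and a
Riemannian metric `g` for which `J` is orthogonal and whose fundamental form
`g(u, J v)` is closed. -/
structure KahlerStructure (N : ℕ) (E : Type*) [NormedAddCommGroup E] [NormedSpace ℝ E]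
    (M : Type*) [TopologicalSpace M] [ChartedSpace E M] [IsManifold 𝓘(ℝ, E) ∞ M] where
  /-- The atlas of complex charts. -/
  charts : ChartedSpace (EuclideanSpace ℂ (Fin N)) M
  /-- The changes of complex charts are holomorphic. -/
  holomorphic_charts : IsManifold 𝓘(ℂ, EuclideanSpace ℂ (Fin N)) ∞ M
  /-- The complex charts are diffeomorphisms for the given smooth structure. -/
  smooth_charts : ∀ e ∈ charts.atlas,
    ContMDiffOn 𝓘(ℝ, E) 𝓘(ℝ, EuclideanSpace ℂ (Fin N)) ∞ e e.source ∧
      ContMDiffOn 𝓘(ℝ, EuclideanSpace ℂ (Fin N)) 𝓘(ℝ, E) ∞ e.symm e.target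
  /-- The complex structure on the real tangent spaces. -/
  J : (x : M) → TangentSpace 𝓘(ℝ, E) x →L[ℝ] TangentSpace 𝓘(ℝ, E) x
  /-- In complex charts, `J` is the multiplication by `i`. -/
  deriv_J : ∀ e ∈ charts.atlas, ∀ x ∈ e.source, ∀ u : TangentSpace 𝓘(ℝ, E) x,
    vderiv e x (J x u) = Complex.I • vderiv e x u
  /-- The Riemannian metric. -/
  g : Bundle.ContMDiffRiemannianMetric 𝓘(ℝ, E) ∞ E (fun x : M => TangentSpace 𝓘(ℝ, E) x)
  /-- The metric is Hermitian. -/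
  hermitian : ∀ x, ∀ u v : TangentSpace 𝓘(ℝ, E) x,
    g.inner x (J x u) (J x v) = g.inner x u v
  /-- The fundamental form, or Kähler form. -/
  form : Form E M ℝ 2
  form_apply : ∀ x, ∀ u v : TangentSpace 𝓘(ℝ, E) x, form x ![u, v] = g.inner x u (J x v)
  /-- The Kähler form is closed. -/
  closed : ∀ x, form.d x = 0

/-- The holomorphic tangent space `{u - i J u}` at `x`, i.e. the vectors of type `(1,0)`. -/
def KahlerStructure.typeOneZero {N : ℕ} {E : Type*} [NormedAddCommGroup E] [NormedSpace ℝ E]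
    {M : Type*} [TopologicalSpace M] [ChartedSpace E M] [IsManifold 𝓘(ℝ, E) ∞ M]
    (S : KahlerStructure N E M) (x : M) : Set (CTangent E x) :=
  {Z | ∃ u : TangentSpace 𝓘(ℝ, E) x, Z = mkT u (-S.J x u)}

/-! ## The Fubini-Study geometry of a projective Hilbert space -/

section FubiniStudy

variable {H : Type*} [NormedAddCommGroup H] [InnerProductSpace ℂ H]

/-- The (complex) tangent space `Hom(l, lᗮ)` of the projective space of `H` at the line `l`. -/
abbrev ProjTangent (l : ℙ ℂ H) := l.submodule →L[ℂ] (l.submodule)ᗮ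

/-- A nonzero vector on the line `l`. -/
def lineVec (l : ℙ ℂ H) : l.submodule :=
  ⟨l.rep, by rw [l.submodule_eq]; exact Submodule.mem_span_singleton_self _⟩

/-- The Hermitian product `⟨A v|B v⟩ / ⟨v|v⟩`, `0 ≠ v ∈ l`, on the tangent space at `l`; it is
antilinear in `A`. -/
def fsHerm {l : ℙ ℂ H} (A B : ProjTangent l) : ℂ :=
  ⟪(A (lineVec l) : H), (B (lineVec l) : H)⟫_ℂ / ⟪(lineVec l : H), (lineVec l : H)⟫_ℂ

/-- The Fubini-Study form `i ⟨dK ∧ dK⟩`, i.e. `i` times the curvature of the canonical connection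
of the tautological line bundle. -/
def fsForm {l : ℙ ℂ H} (A B : ProjTangent l) : ℂ := Complex.I * (fsHerm A B - fsHerm B A)

/-- The Fubini-Study metric; it satisfies `fsForm A B = fsMetric A (i B)`. -/
def fsMetric {l : ℙ ℂ H} (A B : ProjTangent l) : ℝ := 2 * (fsHerm A B).re

end FubiniStudy

/-! ## Maps into a projective Hilbert space -/

section Maps

variable {E : Type*} [NormedAddCommGroup E] [NormedSpace ℝ E]
  {M : Type*} [TopologicalSpace M] [ChartedSpace E M]
  {H : Type*} [NormedAddCommGroup H] [InnerProductSpace ℂ H] (K : M → ℙ ℂ H)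

/-- A smooth local frame over the open set `U` of the line bundle `L → M`, the pullback by `K` of
the tautological bundle, whose fibre at `x` is the line `K x`. This is the same thing as a smooth
map `s : U → H \ {0}` with `[s x] = K x`. Values outside `U` are irrelevant. -/
structure IsFrame (U : Set M) (s : (x : M) → (K x).submodule) : Prop where
  isOpen : IsOpen U
  smooth : ContMDiffOn 𝓘(ℝ, E) 𝓘(ℝ, H) ∞ (fun x => (s x : H)) U
  ne_zero : ∀ x ∈ U, s x ≠ 0

/-- Smoothness of a map into the projective Hilbert space: it lifts locally to smooth maps
into `H \ {0}`. -/
def SmoothMap : Prop := ∀ x : M, ∃ U s, IsFrame (E := E) K U s ∧ x ∈ U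

open Classical in
/-- Some frame near `x` (zero if there is none). -/
def frameAt (x : M) : (y : M) → (K y).submodule :=
  if h : ∃ s, ∃ U, IsFrame (E := E) K U s ∧ x ∈ U then h.choose else 0

/-- The connection form `Θ = ⟨s|ds⟩ / ⟨s|s⟩` of the pullback of the Fubini-Study connection,
`∇ s = Θ ⊗ s`, in the frame `s`. -/
def connForm (s : (x : M) → (K x).submodule) (x : M) : TangentSpace 𝓘(ℝ, E) x →L[ℝ] ℂ :=
  (⟪(s x : H), (s x : H)⟫_ℂ)⁻¹ •
    ((innerSL ℂ (s x : H)).restrictScalars ℝ).comp (vderiv (fun y => (s y : H)) x)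

/-- The connection form as a differential form of degree one. -/
def connForm₁ (s : (x : M) → (K x).submodule) : Form E M ℂ 1 := fun x =>
  ContinuousAlternatingMap.ofSubsingleton ℝ (TangentSpace 𝓘(ℝ, E) x) ℂ (0 : Fin 1)
    (connForm K s x)

/-- The form `i curv ∇ = i dΘ` (`dΘ` does not depend on the frame). -/
def curvForm : Form E M ℂ 2 := fun x =>
  Complex.I • (connForm₁ K (frameAt (E := E) K x)).d x

/-- The differential of `K` at `x`: the linear map from the line `K x` to its orthogonal complement
that sends `s x` to the projection of `ds(u)` (it does not depend on the frame `s`). -/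
def projDeriv (x : M) (u : TangentSpace 𝓘(ℝ, E) x) : ProjTangent (K x) :=
  let s := frameAt (E := E) K x
  (⟪(s x : H), (s x : H)⟫_ℂ)⁻¹ •
    ((innerSL ℂ (s x : H)).comp (K x).submodule.subtypeL).smulRight
      ((K x).submoduleᗮ.orthogonalProjectionOnto (vderiv (fun y => (s y : H)) x u))

/-- `K` is a Kähler immersion of the Kähler manifold `(M, S)`: a holomorphic immersion that pulls
the Fubini-Study metric and form back to the metric and the form of `M`. Holomorphic means
that `K` lifts locally to holomorphic maps into `H \ {0}`. -/
structure IsKahlerImmersion [IsManifold 𝓘(ℝ, E) ∞ M] {N : ℕ} (S : KahlerStructure N E M) :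
    Prop where
  holomorphic : ∀ x : M, ∃ U s, IsFrame (E := E) K U s ∧ x ∈ U ∧
    letI := S.charts
    MDifferentiableOn 𝓘(ℂ, EuclideanSpace ℂ (Fin N)) 𝓘(ℂ, H) (fun y => (s y : H)) U
  immersion : ∀ x, Function.Injective (projDeriv (E := E) K x)
  metric : ∀ x, ∀ u v : TangentSpace 𝓘(ℝ, E) x,
    fsMetric (projDeriv K x u) (projDeriv K x v) = S.g.inner x u v
  form : ∀ x, ∀ u v : TangentSpace 𝓘(ℝ, E) x,
    fsForm (projDeriv K x u) (projDeriv K x v) = (S.form x ![u, v] : ℂ)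

/-- The sections of the line bundle dual to the complex conjugate of `L`: its fibre at `x`
consists of the antilinear functionals on the line `K x`. -/
abbrev DualSection := (x : M) → ((K x).submodule →ₛₗ[starRingEnd ℂ] ℂ)

/-- The section `x ↦ ⟨ · |v⟩` defined by the vector `v` of the Hilbert space. -/
def vecSection (v : H) : DualSection K := fun x =>
  { toFun := fun w => ⟪(w : H), v⟫_ℂ
    map_add' := fun w w' => by simp
    map_smul' := fun c w => by simp [mul_comm] }

/-- The component in the frame dual to `conj s` of the covariant derivative of the section `ψ` in
the direction of the complex tangent vector `Z` at `x`, that is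
`Z(ψ(s)) - conj(Θ(conj Z)) ψ(s)`. -/
def covDeriv (s : (x : M) → (K x).submodule) (ψ : DualSection K) (x : M) (Z : CTangent E x) : ℂ :=
  extC (vderiv (fun y => ψ y (s y)) x) Z
    - starRingEnd ℂ (extC (connForm K s x) (conjT Z)) * ψ x (s x)

/-- The complex distribution `P`, spanned by the smooth complex vector fields that annihilate all
the sections given by the vectors of the Hilbert space. -/
def distribution [IsManifold 𝓘(ℝ, E) ∞ M] (x : M) : Submodule ℂ (CTangent E x) :=
  Submodule.span ℂ {Z | ∃ X : (y : M) → CTangent E y, SmoothField X ∧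
    (∀ v : H, ∀ U s, IsFrame (E := E) K U s → ∀ y ∈ U, covDeriv K s (vecSection K v) y (X y) = 0) ∧
    X x = Z}

/-- The algebra of smooth functions `l` on `M` that multiply the space of sections given by the
vectors of the Hilbert space into itself. -/
def multipliers : Set (M → ℂ) :=
  {l | ContMDiff 𝓘(ℝ, E) 𝓘(ℝ, ℂ) ∞ l ∧
    ∀ v : H, ∃ w : H, ∀ x, l x • vecSection K v x = vecSection K w x}

/-- Coherent state maps, where `dim M = 2 N`. -/
structure IsCoherentStateMap [IsManifold 𝓘(ℝ, E) ∞ M] (N : ℕ) : Prop where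
  dim_eq : finrank ℝ E = 2 * N
  smooth : SmoothMap (E := E) K
  /-- The image is linearly dense. -/
  total : (⨆ x, (K x).submodule).topologicalClosure = ⊤
  nondegenerate : ∀ x, ∀ u : TangentSpace 𝓘(ℝ, E) x,
    (∀ v : TangentSpace 𝓘(ℝ, E) x, curvForm K x ![u, v] = 0) → u = 0
  maximal : ∀ x, finrank ℂ (distribution (E := E) K x) = N
  coordinates : ∀ x : M, ∃ U : Set M, IsOpen U ∧ x ∈ U ∧ ∃ l : Fin N → M → ℂ,
    (∀ i, l i ∈ multipliers (E := E) K) ∧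
      ∀ y ∈ U, LinearIndependent ℂ (fun i => (vderiv (l i) y : TangentSpace 𝓘(ℝ, E) y →L[ℝ] ℂ))

end Maps

end CoherentState

end

open CoherentState

/-! Everything is governed by one real linear map, D = `hderiv s x`: the derivative of a local frame
s at x, projected to the orthogonal complement of s x. Another frame multiplies D by a nonzero
scalar, so h(u, v) = ⟨Du|Dv⟩/⟨s|s⟩ (`frameHerm`) is intrinsic. It is the pull-back of the
Fubini–Study product, ω = -2 Im h (`IsFrame.curvForm_eq`), and the covariant derivative of I(v)
along Z is ⟨D(conj Z)|v⟩ (`IsFrame.covDeriv_eq`), D being extended complex linearly.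

Non-degeneracy of ω makes D injective. A solution Z of D(conj Z) = 0 is then determined by its real
part, so the solutions form a space of complex dimension at most N. It contains P, and the rank
hypothesis forces equality. By dimension every real vector is the real part of a solution, so the
image of D is a complex subspace and J = D⁻¹ i D makes sense. Hence P = {u - iJu}, g = 2 Re h
satisfies g(u, Jv) = ω(u, v), and P is isotropic, transversal and positive pointwise. Closedness
holds because ω is locally the differential of Re(iΘ).

Integrability comes from the multipliers rather than from Newlander–Nirenberg. By the Leibniz rule P
annihilates every multiplier (`IsFrame.extC_vderiv_multiplier`), so conjugates of multipliers have
J-linear differentials. By the inverse function theorem N independent ones give a complex chart, and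
the transition maps, being smooth with complex linear derivative, are holomorphic
(`contDiffOn_complex`). Moreover P is locally the common kernel of N differentials, hence
involutive. Frames normalised by ⟨v|s⟩ = 1 are holomorphic, so the given map is.

Finally P is Lagrangian (`mem_distribution_of_orthogonal`). The field X_λ is ω-orthogonal to P
because P annihilates λ, so X_λ lies in P; N independent differentials give N independent such
fields. -/

noncomputable section

namespace CoherentState

/-! ### Linear algebra of the complexification -/

section Complexification

variable {V : Type*} [AddCommGroup V] [Module ℝ V]

lemma extT {X Y : ℂ ⊗[ℝ] V} (h₁ : reT X = reT Y) (h₂ : imT X = imT Y) : X = Y := by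
  rw [← mkT_reT_imT X, ← mkT_reT_imT Y, h₁, h₂]

lemma reT_smul (c : ℂ) (X : ℂ ⊗[ℝ] V) : reT (c • X) = c.re • reT X - c.im • imT X := by
  induction X using TensorProduct.induction_on with
  | zero => simp
  | tmul z v => simp [reT, imT, TensorProduct.smul_tmul', sub_smul, mul_smul]
  | add X Y hX hY => simp only [smul_add, map_add, hX, hY]; abel

lemma imT_smul (c : ℂ) (X : ℂ ⊗[ℝ] V) : imT (c • X) = c.re • imT X + c.im • reT X := by
  induction X using TensorProduct.induction_on with
  | zero => simp
  | tmul z v => simp [reT, imT, TensorProduct.smul_tmul', add_smul, mul_smul]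
  | add X Y hX hY => simp only [smul_add, map_add, hX, hY]; abel

@[simp] lemma reT_conjT (X : ℂ ⊗[ℝ] V) : reT (conjT X) = reT X := by simp [conjT]

@[simp] lemma imT_conjT (X : ℂ ⊗[ℝ] V) : imT (conjT X) = -imT X := by simp [conjT]

lemma conjT_conjT (X : ℂ ⊗[ℝ] V) : conjT (conjT X) = X := extT (by simp) (by simp)

lemma finrank_complexification [FiniteDimensional ℝ V] :
    finrank ℂ (ℂ ⊗[ℝ] V) = finrank ℝ V := Module.finrank_baseChange

variable [TopologicalSpace V] {F : Type*} [NormedAddCommGroup F] [NormedSpace ℂ F]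

/-- The complex linear extension of a real linear map, as a linear map. -/
def extCₗ (L : V →L[ℝ] F) : ℂ ⊗[ℝ] V →ₗ[ℂ] F where
  toFun := extC L
  map_add' X Y := by simp only [extC, map_add, smul_add]; abel
  map_smul' c X := by
    simp only [extC, reT_smul, imT_smul, map_sub, map_add, map_smul, RingHom.id_apply]
    have h (r : ℝ) (a : F) : r • a = (r : ℂ) • a := (Complex.coe_smul r a).symm
    simp only [h, smul_add, smul_smul]
    conv_rhs => rw [← Complex.re_add_im c]
    have : (Complex.I * Complex.I) = -1 := Complex.I_mul_I
    simp only [add_mul, add_smul]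
    rw [show (c.im : ℂ) * Complex.I * Complex.I = -c.im by rw [mul_assoc, this]; ring,
      mul_comm Complex.I (c.im : ℂ), mul_comm Complex.I (c.re : ℂ), neg_smul]
    abel

@[simp] lemma extCₗ_apply (L : V →L[ℝ] F) (X : ℂ ⊗[ℝ] V) : extCₗ L X = extC L X := rfl

@[simp] lemma extC_mkT (L : V →L[ℝ] F) (u v : V) :
    extC L (mkT u v) = L u + Complex.I • L v := by simp [extC]

lemma extC_conjT (L : V →L[ℝ] F) (X : ℂ ⊗[ℝ] V) :
    extC L (conjT X) = L (reT X) - Complex.I • L (imT X) := by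
  simp [extC, sub_eq_add_neg]

lemma I_smul_I_smul (a : F) : Complex.I • Complex.I • a = -a := by
  rw [smul_smul, Complex.I_mul_I, neg_one_smul]

lemma real_smul_I_smul (r : ℝ) (a : F) : r • Complex.I • a = Complex.I • r • a :=
  smul_comm _ _ _

/-- The vectors `Z` whose conjugates are annihilated by a real linear map. -/
def conjKer (D : V →L[ℝ] F) : Submodule ℂ (ℂ ⊗[ℝ] V) where
  carrier := {Z | D (reT Z) = Complex.I • D (imT Z)}
  zero_mem' := by simp
  add_mem' {Z W} hZ hW := by
    simp only [mem_ofPred_eq, map_add, smul_add] at *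
    rw [hZ, hW]
  smul_mem' c Z hZ := by
    simp only [mem_ofPred_eq, reT_smul, imT_smul, map_add, map_sub, map_smul, smul_add] at *
    rw [hZ, ← smul_comm c.im Complex.I (Complex.I • _), I_smul_I_smul, real_smul_I_smul, smul_neg,
      sub_eq_add_neg]

lemma mem_conjKer {D : V →L[ℝ] F} {Z : ℂ ⊗[ℝ] V} :
    Z ∈ conjKer D ↔ D (reT Z) = Complex.I • D (imT Z) := Iff.rfl

lemma mem_conjKer_iff {D : V →L[ℝ] F} {Z : ℂ ⊗[ℝ] V} :
    Z ∈ conjKer D ↔ extC D (conjT Z) = 0 := by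
  rw [mem_conjKer, extC_conjT, sub_eq_zero]

/-- For Z = u + iw the two memberships read Du = iDw and Du = -iDw, so Du = Dw = 0. This is the
source of P ∩ conj P = 0. -/
lemma eq_zero_of_mem_conjKer {D : V →L[ℝ] F} (hD : Function.Injective D) {Z : ℂ ⊗[ℝ] V}
    (hZ : Z ∈ conjKer D) (hZ' : conjT Z ∈ conjKer D) : Z = 0 := by
  rw [mem_conjKer] at hZ hZ'
  simp only [reT_conjT, imT_conjT, map_neg, smul_neg] at hZ'
  have h₀ : D (reT Z) = 0 := by
    rw [← hZ] at hZ'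
    have h₂ : (2 : ℝ) • D (reT Z) = 0 := by rw [two_smul]; nth_rw 1 [hZ']; simp
    exact (smul_eq_zero.1 h₂).resolve_left two_ne_zero
  have h₁ : D (imT Z) = 0 := by
    rw [h₀] at hZ
    exact (smul_eq_zero.1 hZ.symm).resolve_left Complex.I_ne_zero
  exact extT (hD (by simp [h₀])) (hD (by simp [h₁]))

/-- The relation Du = iDw recovers Dw, hence w, from u. -/
lemma reT_conjKer_injective {D : V →L[ℝ] F} (hD : Function.Injective D) :
    Function.Injective ((reT (V := V)).comp ((conjKer D).restrictScalars ℝ).subtype) := by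
  rw [← LinearMap.ker_eq_bot, LinearMap.ker_eq_bot']
  rintro ⟨Z, hZ⟩ h₀
  have h₁ : reT Z = 0 := h₀
  have hZ' : D (reT Z) = Complex.I • D (imT Z) := hZ
  rw [h₁, map_zero] at hZ'
  have h₂ := (smul_eq_zero.1 hZ'.symm).resolve_left Complex.I_ne_zero
  exact Subtype.ext (extT (by simp [h₁]) (hD (by simp [h₂])))

lemma finrank_conjKer_le [FiniteDimensional ℝ V] {D : V →L[ℝ] F} (hD : Function.Injective D) :
    2 * finrank ℂ (conjKer D) ≤ finrank ℝ V := by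
  rw [← finrank_real_of_complex (conjKer D)]
  exact LinearMap.finrank_le_finrank_of_injective (reT_conjKer_injective hD)

/-- If the kernel has the maximal dimension, the image of a real linear map is complex. -/
lemma exists_I_smul_of_finrank_conjKer [FiniteDimensional ℝ V] {D : V →L[ℝ] F}
    (hD : Function.Injective D) (h : finrank ℝ V = 2 * finrank ℂ (conjKer D)) (u : V) :
    ∃ w, D w = Complex.I • D u := by
  have hf := reT_conjKer_injective hD
  have hfin : finrank ℝ ((conjKer D).restrictScalars ℝ) = finrank ℝ V := by
    rw [h]
    exact finrank_real_of_complex (conjKer D)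
  have hsurj := (LinearMap.injective_iff_surjective_of_finrank_eq_finrank hfin).1 hf
  obtain ⟨⟨Z, hZ⟩, hu⟩ := hsurj u
  have hu' : reT Z = u := hu
  have hZ' : D (reT Z) = Complex.I • D (imT Z) := hZ
  refine ⟨-imT Z, ?_⟩
  rw [← hu', hZ', I_smul_I_smul, map_neg]

/-- The joint kernel of independent linear forms. -/
lemma eq_ker_of_linearIndependent [FiniteDimensional ℝ V] {ι : Type*} [Fintype ι]
    {f : ι → V →L[ℝ] ℂ} (hf : LinearIndependent ℂ f) {P : Submodule ℂ (ℂ ⊗[ℝ] V)}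
    (hP : ∀ i, ∀ Z ∈ P, extC (f i) Z = 0)
    (hd : finrank ℝ V = finrank ℂ P + Fintype.card ι) (Z : ℂ ⊗[ℝ] V) :
    Z ∈ P ↔ ∀ i, extC (f i) Z = 0 := by
  -- A relation between the extended forms restricts to real vectors, where it is a relation between
  -- the original ones.
  have hli : LinearIndependent ℂ (fun i => (extCₗ (f i) : Module.Dual ℂ (ℂ ⊗[ℝ] V))) := by
    rw [Fintype.linearIndependent_iff] at hf ⊢
    intro c hc
    refine hf c ?_
    ext v
    have := LinearMap.congr_fun hc (mkT v 0)
    simpa using this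
  let W := Submodule.span ℂ (Set.range fun i => (extCₗ (f i) : Module.Dual ℂ (ℂ ⊗[ℝ] V)))
  have hW : finrank ℂ W = Fintype.card ι := finrank_span_eq_card hli
  have hWc : finrank ℂ W + finrank ℂ W.dualCoannihilator = finrank ℂ (ℂ ⊗[ℝ] V) :=
    Subspace.finrank_add_finrank_dualCoannihilator_eq W
  have hmem (Z : ℂ ⊗[ℝ] V) : Z ∈ W.dualCoannihilator ↔ ∀ i, extC (f i) Z = 0 := by
    rw [Submodule.mem_dualCoannihilator]
    constructor
    · intro h i
      exact h _ (Submodule.subset_span ⟨i, rfl⟩)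
    · intro h φ hφ
      induction hφ using Submodule.span_induction with
      | mem φ hφ => obtain ⟨i, rfl⟩ := hφ; exact h i
      | zero => simp
      | add φ ψ _ _ h₁ h₂ => simp [h₁, h₂]
      | smul c φ _ h => simp [h]
  have hle : P ≤ W.dualCoannihilator := fun Z hZ => (hmem Z).2 fun i => hP i Z hZ
  have : P = W.dualCoannihilator := by
    apply Submodule.eq_of_le_of_finrank_eq hle
    rw [finrank_complexification] at hWc
    omega
  rw [← hmem, this]

end Complexification

/-! ### Derivatives and smoothness in the preferred charts -/

section Coordinates

open Filter

variable {E : Type*} [NormedAddCommGroup E] [NormedSpace ℝ E]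
  {M : Type*} [TopologicalSpace M] [ChartedSpace E M]
  {F : Type*} [NormedAddCommGroup F] [NormedSpace ℝ F]

/-- The linear isomorphism `E → T_x M` given by the preferred chart at `x₀`. -/
def coordFrame (x₀ x : M) : E →L[ℝ] TangentSpace 𝓘(ℝ, E) x :=
  mfderivWithin 𝓘(ℝ, E) 𝓘(ℝ, E) (extChartAt 𝓘(ℝ, E) x₀).symm (range 𝓘(ℝ, E))
    (extChartAt 𝓘(ℝ, E) x₀ x)

/-- The linear isomorphism `T_x M → E` given by the preferred chart at `x₀`. -/
def coordMap (x₀ x : M) : TangentSpace 𝓘(ℝ, E) x →L[ℝ] E :=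
  mfderiv 𝓘(ℝ, E) 𝓘(ℝ, E) (extChartAt 𝓘(ℝ, E) x₀) x

variable [IsManifold 𝓘(ℝ, E) ∞ M]

lemma coordFrame_coordMap {x₀ x : M} (hx : x ∈ (chartAt E x₀).source)
    (u : TangentSpace 𝓘(ℝ, E) x) : coordFrame x₀ x (coordMap x₀ x u) = u := by
  have h := mfderivWithin_extChartAt_symm_comp_mfderiv_extChartAt' (I := 𝓘(ℝ, E)) (x := x₀) (y := x)
    (by simpa using hx)
  exact DFunLike.congr_fun h u

lemma coordMap_coordFrame {x₀ x : M} (hx : x ∈ (chartAt E x₀).source) (u : E) :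
    coordMap x₀ x (coordFrame x₀ x u) = u := by
  have h := mfderiv_extChartAt_comp_mfderivWithin_extChartAt_symm' (I := 𝓘(ℝ, E)) (x := x₀) (y := x)
    (by simpa using hx)
  exact DFunLike.congr_fun h u

lemma coordMap_self (x : M) (u : TangentSpace 𝓘(ℝ, E) x) : coordMap x x u = u := by
  have := mfderiv_extChartAt_self (I := 𝓘(ℝ, E)) (x := x)
  exact DFunLike.congr_fun this u

lemma coordFrame_self (x : M) (u : E) : coordFrame x x u = (u : TangentSpace 𝓘(ℝ, E) x) := by
  have := coordFrame_coordMap (E := E) (mem_chart_source E x) (show TangentSpace 𝓘(ℝ, E) x from u)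
  rwa [coordMap_self] at this

/-- Chain rule for f composed with the inverse chart. It transfers calculus on `M` to calculus on
`E`. -/
lemma vderiv_comp_coordFrame {f : M → F} {x₀ x : M} (hx : x ∈ (chartAt E x₀).source)
    (hf : MDifferentiableAt 𝓘(ℝ, E) 𝓘(ℝ, F) f x) :
    (vderiv f x).comp (coordFrame x₀ x) =
      fderiv ℝ (f ∘ (chartAt E x₀).symm) (chartAt E x₀ x) := by
  have h₁ : MDifferentiableWithinAt 𝓘(ℝ, E) 𝓘(ℝ, E) (extChartAt 𝓘(ℝ, E) x₀).symm
      (range 𝓘(ℝ, E)) (extChartAt 𝓘(ℝ, E) x₀ x) :=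
    mdifferentiableWithinAt_extChartAt_symm (by simp [hx])
  have h₂ : (extChartAt 𝓘(ℝ, E) x₀).symm (extChartAt 𝓘(ℝ, E) x₀ x) = x :=
    (extChartAt 𝓘(ℝ, E) x₀).left_inv (by simpa using hx)
  have h₃ : MDifferentiableAt 𝓘(ℝ, E) 𝓘(ℝ, F) f
      ((extChartAt 𝓘(ℝ, E) x₀).symm (extChartAt 𝓘(ℝ, E) x₀ x)) := by rwa [h₂]
  have h₄ := mfderiv_comp_mfderivWithin (extChartAt 𝓘(ℝ, E) x₀ x) h₃ h₁
    ((uniqueMDiffWithinAt_iff_uniqueDiffWithinAt).2 (by simp))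
  rw [h₂] at h₄
  refine h₄.symm.trans ?_
  rw [mfderivWithin_eq_fderivWithin]
  simp [extChartAt]
  rfl

lemma vderiv_eq_fderiv {f : M → F} {x : M} (hf : MDifferentiableAt 𝓘(ℝ, E) 𝓘(ℝ, F) f x)
    (u : TangentSpace 𝓘(ℝ, E) x) :
    vderiv f x u = (fderiv ℝ (f ∘ (chartAt E x).symm) (chartAt E x x) : E →L[ℝ] F) u := by
  rw [← vderiv_comp_coordFrame (mem_chart_source E x) hf]
  exact congrArg (vderiv f x) (coordFrame_self (E := E) x u).symm

lemma vderiv_apply_eq {f : M → F} {x₀ x : M} (hx : x ∈ (chartAt E x₀).source)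
    (hf : MDifferentiableAt 𝓘(ℝ, E) 𝓘(ℝ, F) f x) (u : TangentSpace 𝓘(ℝ, E) x) :
    vderiv f x u = fderiv ℝ (f ∘ (chartAt E x₀).symm) (chartAt E x₀ x) (coordMap x₀ x u) := by
  rw [← vderiv_comp_coordFrame hx hf]
  exact congrArg (vderiv f x) (coordFrame_coordMap hx u).symm

lemma contDiffAt_comp_chart_symm {f : M → F} {x₀ x : M} (hx : x ∈ (chartAt E x₀).source)
    (hf : ContMDiffAt 𝓘(ℝ, E) 𝓘(ℝ, F) ∞ f x) :
    ContDiffAt ℝ ∞ (f ∘ (chartAt E x₀).symm) (chartAt E x₀ x) := by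
  rw [← contMDiffAt_iff_contDiffAt]
  have h : ContMDiffAt 𝓘(ℝ, E) 𝓘(ℝ, E) ∞ (chartAt E x₀).symm (chartAt E x₀ x) :=
    (contMDiffOn_chart_symm (I := 𝓘(ℝ, E)) (x := x₀) (n := ∞)).contMDiffAt
      ((chartAt E x₀).open_target.mem_nhds ((chartAt E x₀).map_source hx))
  exact ContMDiffAt.comp _ (by rwa [(chartAt E x₀).left_inv hx]) h

lemma contMDiffAt_chart_self (x₀ : M) {x : M} (hx : x ∈ (chartAt E x₀).source) :
    ContMDiffAt 𝓘(ℝ, E) 𝓘(ℝ, E) ∞ (chartAt E x₀) x :=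
  (contMDiffOn_chart (I := 𝓘(ℝ, E)) (x := x₀) (n := ∞)).contMDiffAt
    ((chartAt E x₀).open_source.mem_nhds hx)

lemma _root_.ContMDiffAt.vderiv_comp_coordFrame {f : M → F} {x₀ : M}
    (hf : ContMDiffAt 𝓘(ℝ, E) 𝓘(ℝ, F) ∞ f x₀) :
    ContMDiffAt 𝓘(ℝ, E) 𝓘(ℝ, E →L[ℝ] F) ∞
      (fun x => ((vderiv f x).comp (coordFrame x₀ x) : E →L[ℝ] F)) x₀ := by
  have h₁ : ContMDiffAt 𝓘(ℝ, E) 𝓘(ℝ, E →L[ℝ] F) ∞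
      (fun x => fderiv ℝ (f ∘ (chartAt E x₀).symm) (chartAt E x₀ x)) x₀ := by
    have h := (contDiffAt_comp_chart_symm (mem_chart_source E x₀) hf).fderiv_right (m := ∞) le_rfl
    exact h.contMDiffAt.comp x₀ (contMDiffAt_chart_self x₀ (mem_chart_source E x₀))
  refine h₁.congr_of_eventuallyEq ?_
  have h₂ : ∀ᶠ x in 𝓝 x₀, ContMDiffAt 𝓘(ℝ, E) 𝓘(ℝ, F) 1 f x :=
    (contMDiffAt_iff_contMDiffAt_nhds (by simp)).1 (hf.of_le (by simp))
  filter_upwards [h₂, (chartAt E x₀).open_source.mem_nhds (mem_chart_source E x₀)] with x hx hx'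
  exact CoherentState.vderiv_comp_coordFrame hx' (hx.mdifferentiableAt one_ne_zero)

/-- The trivialization of the tangent bundle at `x₀` is the derivative of the chart at `x₀`, so
smoothness of a field is smoothness of its components there. -/
lemma contMDiffAt_field_of_coord {X : (x : M) → TangentSpace 𝓘(ℝ, E) x} {x₀ : M} {a : M → E}
    (ha : ContMDiffAt 𝓘(ℝ, E) 𝓘(ℝ, E) ∞ a x₀) (h : ∀ᶠ x in 𝓝 x₀, coordMap x₀ x (X x) = a x) :
    ContMDiffAt 𝓘(ℝ, E) 𝓘(ℝ, E).tangent ∞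
      (fun x => (⟨x, X x⟩ : TangentBundle 𝓘(ℝ, E) M)) x₀ := by
  refine (Bundle.contMDiffAt_section (E := fun x : M => TangentSpace 𝓘(ℝ, E) x) x₀).2 ?_
  refine ha.congr_of_eventuallyEq ?_
  filter_upwards [h, (chartAt E x₀).open_source.mem_nhds (mem_chart_source E x₀)] with x hx hx'
  rw [← hx, coordMap, ← TangentBundle.continuousLinearMapAt_trivializationAt hx']
  rw [Bundle.Trivialization.continuousLinearMapAt_apply, Bundle.Trivialization.linearMapAt_apply,
    if_pos (by simpa using hx')]

lemma contMDiffAt_coordMap_field {X : (x : M) → TangentSpace 𝓘(ℝ, E) x} {x₀ : M}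
    (hX : ContMDiffAt 𝓘(ℝ, E) 𝓘(ℝ, E).tangent ∞
      (fun x => (⟨x, X x⟩ : TangentBundle 𝓘(ℝ, E) M)) x₀) :
    ContMDiffAt 𝓘(ℝ, E) 𝓘(ℝ, E) ∞ (fun x => coordMap x₀ x (X x)) x₀ := by
  have := (Bundle.contMDiffAt_section (E := fun x : M => TangentSpace 𝓘(ℝ, E) x) x₀).1 hX
  refine this.congr_of_eventuallyEq ?_
  filter_upwards [(chartAt E x₀).open_source.mem_nhds (mem_chart_source E x₀)] with x hx'
  rw [coordMap, ← TangentBundle.continuousLinearMapAt_trivializationAt hx']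
  rw [Bundle.Trivialization.continuousLinearMapAt_apply, Bundle.Trivialization.linearMapAt_apply,
    if_pos (by simpa using hx')]

/-- Smoothness of a family of bilinear forms on the tangent spaces can be checked in the
coordinates of a chart. -/
lemma contMDiffAt_bilin_of_coord
    {b : (x : M) → TangentSpace 𝓘(ℝ, E) x →L[ℝ] TangentSpace 𝓘(ℝ, E) x →L[ℝ] ℝ} {x₀ : M}
    {a : M → E →L[ℝ] E →L[ℝ] ℝ}
    (ha : ContMDiffAt 𝓘(ℝ, E) 𝓘(ℝ, E →L[ℝ] E →L[ℝ] ℝ) ∞ a x₀)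
    (h : ∀ᶠ x in 𝓝 x₀, ∀ u v, a x u v = b x (coordFrame x₀ x u) (coordFrame x₀ x v)) :
    ContMDiffAt 𝓘(ℝ, E) (𝓘(ℝ, E).prod 𝓘(ℝ, E →L[ℝ] E →L[ℝ] ℝ)) ∞
      (fun x => Bundle.TotalSpace.mk' (E →L[ℝ] E →L[ℝ] ℝ)
        (E := fun x : M => TangentSpace 𝓘(ℝ, E) x →L[ℝ] TangentSpace 𝓘(ℝ, E) x →L[ℝ] ℝ)
        x (b x)) x₀ := by
  refine (contMDiffAt_hom_bundle _).2 ⟨contMDiffAt_id, ?_⟩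
  refine ha.congr_of_eventuallyEq ?_
  filter_upwards [h, (chartAt E x₀).open_source.mem_nhds (mem_chart_source E x₀)] with x hx hx'
  ext u v
  rw [hx]
  have hx'' : x ∈ (trivializationAt E (fun x : M => TangentSpace 𝓘(ℝ, E) x) x₀).baseSet := by
    simpa using hx'
  rw [inCoordinates_apply_eq₂ hx'' hx'' (Set.mem_univ _)]
  simp only [coordFrame, ← TangentBundle.symmL_trivializationAt hx',
    Bundle.Trivialization.symmL_apply _ hx'']
  simp

end Coordinates

/-! ### Exterior derivative of one-forms on a vector space -/

section OneForms

lemma two_le_smooth : minSmoothness ℝ 2 ≤ (∞ : WithTop ℕ∞) := by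
  rw [minSmoothness_of_isRCLikeNormedField]
  exact WithTop.coe_le_coe.2 (le_top : (2 : ℕ∞) ≤ ⊤)

variable {E : Type*} [NormedAddCommGroup E] [NormedSpace ℝ E]
  {F : Type*} [NormedAddCommGroup F] [NormedSpace ℝ F]

lemma contDiffAt_ofSubsingleton {θ : E → E →L[ℝ] F} {y : E} {n : WithTop ℕ∞}
    (hθ : ContDiffAt ℝ n θ y) :
    ContDiffAt ℝ n
      (fun z => ContinuousAlternatingMap.ofSubsingleton ℝ E F (0 : Fin 1) (θ z)) y :=
  (ContinuousAlternatingMap.ofSubsingletonLIE (𝕜 := ℝ) (E := E) (F := F) (0 : Fin 1)).toContinuousLinearEquiv.toContinuousLinearMap.contDiff.contDiffAt.comp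
    y hθ

lemma extDeriv_ofSubsingleton {θ : E → E →L[ℝ] F} {y : E} (hθ : DifferentiableAt ℝ θ y)
    (u v : E) :
    extDeriv (fun z => ContinuousAlternatingMap.ofSubsingleton ℝ E F (0 : Fin 1) (θ z)) y ![u, v] =
      fderiv ℝ θ y u v - fderiv ℝ θ y v u := by
  have h : DifferentiableAt ℝ
      (fun z => ContinuousAlternatingMap.ofSubsingleton ℝ E F (0 : Fin 1) (θ z)) y :=
    (ContinuousAlternatingMap.ofSubsingletonLIE (𝕜 := ℝ) (E := E) (F := F) (0 : Fin 1)).toContinuousLinearEquiv.differentiableAt.comp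
      y hθ
  rw [extDeriv_apply h]
  have h' (w z : E) : fderiv ℝ (fun x => θ x w) y z = fderiv ℝ θ y z w := by
    rw [fderiv_clm_apply hθ (by fun_prop)]
    simp
  simp [Fin.sum_univ_two, Fin.removeNth, h', sub_eq_add_neg]

end OneForms

/-! ### Orthogonal projection off a line, and the curvature of the connection form -/

section Horizontal

variable {H : Type*} [NormedAddCommGroup H] [InnerProductSpace ℂ H]

/-- The projection of the vector `a` to the orthogonal complement of `s`. -/
def horiz (s : H) : H →L[ℂ] H :=
  ContinuousLinearMap.id ℂ H - ((⟪s, s⟫_ℂ)⁻¹ • innerSL ℂ s).smulRight s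

lemma horiz_apply (s a : H) : horiz s a = a - ((⟪s, s⟫_ℂ)⁻¹ * ⟪s, a⟫_ℂ) • s := by
  simp [horiz]

lemma inner_self_ne {s : H} (hs : s ≠ 0) : ⟪s, s⟫_ℂ ≠ 0 := inner_self_ne_zero.2 hs

lemma inner_horiz_right {s : H} (hs : s ≠ 0) (a : H) : ⟪s, horiz s a⟫_ℂ = 0 := by
  rw [horiz_apply, inner_sub_right, inner_smul_right]
  have := inner_self_ne hs
  generalize ⟪s, s⟫_ℂ = q at *
  field_simp
  ring

lemma inner_horiz_left {s : H} (hs : s ≠ 0) (a : H) : ⟪horiz s a, s⟫_ℂ = 0 := by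
  rw [← inner_conj_symm, inner_horiz_right hs, map_zero]

lemma inner_horiz_horiz {s : H} (hs : s ≠ 0) (a b : H) :
    ⟪horiz s a, horiz s b⟫_ℂ = ⟪a, b⟫_ℂ - (⟪s, s⟫_ℂ)⁻¹ * (⟪a, s⟫_ℂ * ⟪s, b⟫_ℂ) := by
  conv_lhs => rw [horiz_apply s b, inner_sub_right, inner_smul_right, inner_horiz_left hs,
    horiz_apply, inner_sub_left, inner_smul_left]
  simp only [map_mul, map_inv₀, inner_conj_symm, mul_zero, sub_zero]
  ring

lemma horiz_self {s : H} (hs : s ≠ 0) : horiz s s = 0 := by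
  rw [horiz_apply, inv_mul_cancel₀ (inner_self_ne hs), one_smul, sub_self]

lemma horiz_smul_left {c : ℂ} (hc : c ≠ 0) (s a : H) : horiz (c • s) a = horiz s a := by
  simp only [horiz_apply, inner_smul_left, inner_smul_right, smul_smul, sub_right_inj]
  congr 1
  have : (starRingEnd ℂ) c ≠ 0 := by simpa using hc
  field_simp

lemma inner_horiz_eq_inner (s a v : H) :
    ⟪horiz s a, v⟫_ℂ = ⟪a, v⟫_ℂ - (starRingEnd ℂ) ((⟪s, s⟫_ℂ)⁻¹ * ⟪s, a⟫_ℂ) * ⟪s, v⟫_ℂ := by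
  rw [horiz_apply, inner_sub_left, inner_smul_left]

variable {E : Type*} [NormedAddCommGroup E] [NormedSpace ℝ E]

/-- The connection form of a nowhere vanishing map from `E` to `H`. -/
def flatConn (s : E → H) (y : E) : E →L[ℝ] ℂ :=
  (⟪s y, s y⟫_ℂ)⁻¹ • ((innerSL ℂ (s y)).restrictScalars ℝ).comp (fderiv ℝ s y)

lemma flatConn_apply (s : E → H) (y u : E) :
    flatConn s y u = (⟪s y, s y⟫_ℂ)⁻¹ * ⟪s y, fderiv ℝ s y u⟫_ℂ := by
  simp [flatConn]

lemma contDiffAt_flatConn {s : E → H} {y : E} (hs : ContDiffAt ℝ ∞ s y) (h₀ : s y ≠ 0) :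
    ContDiffAt ℝ ∞ (flatConn s) y := by
  let L : H →L[ℝ] H →L[ℝ] ℂ := (isBoundedBilinearMap_inner (𝕜 := ℂ) (E := H)).toContinuousLinearMap
  have h₁ : ContDiffAt ℝ ∞ (fun x => (⟪s x, s x⟫_ℂ)⁻¹) y := (hs.inner ℂ hs).inv (inner_self_ne h₀)
  have h₂ : ContDiffAt ℝ ∞ (fun x => (L (s x)).comp (fderiv ℝ s x)) y :=
    (L.contDiff.contDiffAt.comp y hs).clm_comp (hs.fderiv_right (m := ∞) le_rfl)
  exact h₁.smul h₂

/-- Antisymmetrising removes the second derivatives of `s`. The derivative of 1/⟨s|s⟩ contributes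
exactly the correction that turns ⟨ds(u)|ds(v)⟩ into the product of the horizontal parts. -/
lemma fderiv_flatConn_sub {s : E → H} {y : E} (hs : ContDiffAt ℝ ∞ s y) (h₀ : s y ≠ 0) (u v : E) :
    fderiv ℝ (flatConn s) y u v - fderiv ℝ (flatConn s) y v u =
      (⟪horiz (s y) (fderiv ℝ s y u), horiz (s y) (fderiv ℝ s y v)⟫_ℂ -
        ⟪horiz (s y) (fderiv ℝ s y v), horiz (s y) (fderiv ℝ s y u)⟫_ℂ) / ⟪s y, s y⟫_ℂ := by
  have hd : DifferentiableAt ℝ s y := hs.differentiableAt (by simp)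
  have hd' : DifferentiableAt ℝ (fderiv ℝ s) y :=
    (hs.fderiv_right (m := ∞) le_rfl).differentiableAt (by simp)
  have hθ : DifferentiableAt ℝ (flatConn s) y := (contDiffAt_flatConn hs h₀).differentiableAt (by simp)
  have hsymm : fderiv ℝ (fderiv ℝ s) y u v = fderiv ℝ (fderiv ℝ s) y v u :=
    (hs.isSymmSndFDerivAt two_le_smooth).eq u v
  have key (u v : E) : fderiv ℝ (flatConn s) y u v =
      -(⟪s y, s y⟫_ℂ)⁻¹ ^ 2 * (⟪fderiv ℝ s y u, s y⟫_ℂ + ⟪s y, fderiv ℝ s y u⟫_ℂ) *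
        ⟪s y, fderiv ℝ s y v⟫_ℂ + (⟪s y, s y⟫_ℂ)⁻¹ *
          (⟪fderiv ℝ s y u, fderiv ℝ s y v⟫_ℂ + ⟪s y, fderiv ℝ (fderiv ℝ s) y u v⟫_ℂ) := by
    have h₁ : fderiv ℝ (flatConn s) y u v = fderiv ℝ (fun z => flatConn s z v) y u := by
      rw [fderiv_clm_apply hθ (by fun_prop)]; simp
    have hv : HasFDerivAt (fun z => fderiv ℝ s z v) ((fderiv ℝ (fderiv ℝ s) y).flip v) y := by
      have := hd'.hasFDerivAt.clm_apply (hasFDerivAt_const v y)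
      simpa using this
    have h₂ := hd.hasFDerivAt.inner ℂ hd.hasFDerivAt
    have h₃ := hd.hasFDerivAt.inner ℂ hv
    have h₄ := ((hasDerivAt_inv (inner_self_ne h₀)).hasFDerivAt.restrictScalars ℝ).comp y h₂
    have h₅ := h₄.mul h₃
    rw [h₁]
    have h₆ : (fun z => flatConn s z v) =
      (fun z => (Inv.inv ∘ fun t => ⟪s t, s t⟫_ℂ) z * ⟪s z, fderiv ℝ s z v⟫_ℂ) := by
      ext z; simp [flatConn_apply]
    rw [h₆]
    erw [h₅.fderiv]
    simp
    ring
  rw [key, key, hsymm, inner_horiz_horiz h₀, inner_horiz_horiz h₀]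
  have := inner_self_ne h₀
  generalize ⟪s y, s y⟫_ℂ = q at *
  field_simp
  ring

end Horizontal

/-! ### Frames of the line bundle and their horizontal derivatives -/

section Frames

open Filter

variable {E : Type*} [NormedAddCommGroup E] [NormedSpace ℝ E]
  {M : Type*} [TopologicalSpace M] [ChartedSpace E M]
  {H : Type*} [NormedAddCommGroup H] [InnerProductSpace ℂ H] {K : M → ℙ ℂ H}

/-- The horizontal part of the differential of a frame. -/
def hderiv (s : (x : M) → (K x).submodule) (x : M) : TangentSpace 𝓘(ℝ, E) x →L[ℝ] H :=
  ((horiz (s x : H)).restrictScalars ℝ).comp (vderiv (fun y => (s y : H)) x)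

lemma hderiv_apply (s : (x : M) → (K x).submodule) (x : M) (u : TangentSpace 𝓘(ℝ, E) x) :
    hderiv s x u = horiz (s x : H) (vderiv (fun y => (s y : H)) x u) := rfl

lemma connForm_apply (s : (x : M) → (K x).submodule) (x : M) (u : TangentSpace 𝓘(ℝ, E) x) :
    connForm K s x u = (⟪(s x : H), (s x : H)⟫_ℂ)⁻¹ *
      ⟪(s x : H), vderiv (fun y => (s y : H)) x u⟫_ℂ := rfl

section Chain

variable {F G : Type*} [NormedAddCommGroup F] [NormedSpace ℝ F]
  [NormedAddCommGroup G] [NormedSpace ℝ G] {x : M}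

lemma vderiv_comp {g : F → G} {f : M → F} (hg : DifferentiableAt ℝ g (f x))
    (hf : MDifferentiableAt 𝓘(ℝ, E) 𝓘(ℝ, F) f x) (u : TangentSpace 𝓘(ℝ, E) x) :
    vderiv (fun y => g (f y)) x u = fderiv ℝ g (f x) (vderiv f x u) := by
  have h := mfderiv_comp_apply (I' := 𝓘(ℝ, F)) (I'' := 𝓘(ℝ, G)) x hg.mdifferentiableAt hf u
  rw [mfderiv_eq_fderiv] at h
  exact h

lemma vderiv_clm_comp (L : F →L[ℝ] G) {f : M → F}
    (hf : MDifferentiableAt 𝓘(ℝ, E) 𝓘(ℝ, F) f x) (u : TangentSpace 𝓘(ℝ, E) x) :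
    vderiv (fun y => L (f y)) x u = L (vderiv f x u) := by
  rw [vderiv_comp L.differentiableAt hf, L.fderiv]

lemma vderiv_prodMk {f : M → F} {g : M → G} (hf : MDifferentiableAt 𝓘(ℝ, E) 𝓘(ℝ, F) f x)
    (hg : MDifferentiableAt 𝓘(ℝ, E) 𝓘(ℝ, G) g x) (u : TangentSpace 𝓘(ℝ, E) x) :
    vderiv (fun y => (f y, g y)) x u = (vderiv f x u, vderiv g x u) := by
  have h := hf.prodMk_space hg
  exact Prod.ext (vderiv_clm_comp (ContinuousLinearMap.fst ℝ F G) h u).symm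
    (vderiv_clm_comp (ContinuousLinearMap.snd ℝ F G) h u).symm

lemma vderiv_smul {c : M → ℂ} {f : M → H} (hc : MDifferentiableAt 𝓘(ℝ, E) 𝓘(ℝ, ℂ) c x)
    (hf : MDifferentiableAt 𝓘(ℝ, E) 𝓘(ℝ, H) f x) (u : TangentSpace 𝓘(ℝ, E) x) :
    vderiv (fun y => c y • f y) x u = c x • vderiv f x u + vderiv c x u • f x := by
  have h : HasFDerivAt (fun p : ℂ × H => p.1 • p.2)
      (c x • ContinuousLinearMap.snd ℝ ℂ H + (ContinuousLinearMap.fst ℝ ℂ H).smulRight (f x))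
      (c x, f x) :=
    (hasFDerivAt_fst (𝕜 := ℝ) (p := (c x, f x))).smul (hasFDerivAt_snd (𝕜 := ℝ) (p := (c x, f x)))
  have h' := vderiv_comp (f := fun y => (c y, f y)) h.differentiableAt (hc.prodMk_space hf) u
  rw [vderiv_prodMk hc hf, h.fderiv] at h'
  exact h'

end Chain

namespace IsFrame

variable {U V : Set M} {s t : (x : M) → (K x).submodule} {x : M}

lemma contMDiffAt (hs : IsFrame (E := E) K U s) (hx : x ∈ U) :
    ContMDiffAt 𝓘(ℝ, E) 𝓘(ℝ, H) ∞ (fun y => (s y : H)) x :=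
  hs.smooth.contMDiffAt (hs.isOpen.mem_nhds hx)

lemma mdifferentiableAt (hs : IsFrame (E := E) K U s) (hx : x ∈ U) :
    MDifferentiableAt 𝓘(ℝ, E) 𝓘(ℝ, H) (fun y => (s y : H)) x :=
  (hs.contMDiffAt hx).mdifferentiableAt (by simp)

lemma coe_ne_zero (hs : IsFrame (E := E) K U s) (hx : x ∈ U) : (s x : H) ≠ 0 := fun h =>
  hs.ne_zero x hx (Subtype.ext h)

lemma vderiv_vecSection (hs : IsFrame (E := E) K U s) (hx : x ∈ U) (v : H)
    (u : TangentSpace 𝓘(ℝ, E) x) :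
    vderiv (fun y => vecSection K v y (s y)) x u =
      ⟪vderiv (fun y => (s y : H)) x u, v⟫_ℂ := by
  let L : H →L[ℝ] H →L[ℝ] ℂ := (isBoundedBilinearMap_inner (𝕜 := ℂ) (E := H)).toContinuousLinearMap
  exact vderiv_clm_comp (L.flip v) (hs.mdifferentiableAt hx) u

/-- The connection term is the component of `ds` along `s`, so subtracting it projects `ds` off `s`.
The conjugate of `Z` appears because the scalar product is antilinear in `s`. -/
lemma covDeriv_eq (hs : IsFrame (E := E) K U s) (hx : x ∈ U) (v : H) (Z : CTangent E x) :
    covDeriv K s (vecSection K v) x Z = ⟪extC (hderiv s x) (conjT Z), v⟫_ℂ := by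
  have h : (vecSection K v x) (s x) = ⟪(s x : H), v⟫_ℂ := rfl
  rw [covDeriv, h]
  simp only [extC, reT_conjT, imT_conjT, hs.vderiv_vecSection hx, map_neg, map_add, smul_neg,
    inner_add_left, inner_neg_left, inner_smul_left, hderiv_apply, inner_horiz_eq_inner,
    connForm_apply, smul_eq_mul, map_mul, Complex.conj_I]
  ring

lemma exists_smul (hs : IsFrame (E := E) K U s) (hx : x ∈ U) (w : (K x).submodule) :
    (w : H) = ((⟪(s x : H), (s x : H)⟫_ℂ)⁻¹ * ⟪(s x : H), (w : H)⟫_ℂ) • (s x : H) := by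
  obtain ⟨c, hc⟩ : ∃ c : ℂ, c • (s x : H) = w := by
    have h : (K x).submodule = Submodule.span ℂ {(s x : H)} := by
      have h₁ : (s x : H) ∈ Submodule.span ℂ {(K x).rep} := by
        rw [← (K x).submodule_eq]; exact (s x).2
      obtain ⟨a, ha⟩ := Submodule.mem_span_singleton.1 h₁
      have ha₀ : a ≠ 0 := by
        rintro rfl
        exact hs.coe_ne_zero hx (by rw [← ha, zero_smul])
      refine (K x).submodule_eq.trans ?_
      rw [← ha, Submodule.span_singleton_smul_eq (IsUnit.mk0 a ha₀)]
    have : (w : H) ∈ Submodule.span ℂ {(s x : H)} := h ▸ w.2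
    exact Submodule.mem_span_singleton.1 this
  rw [← hc, inner_smul_right]
  have := inner_self_ne (hs.coe_ne_zero hx)
  congr 1
  field_simp

lemma contMDiffAt_coeff (hs : IsFrame (E := E) K U s) (hx : x ∈ U) {f : M → H}
    (hf : ContMDiffAt 𝓘(ℝ, E) 𝓘(ℝ, H) ∞ f x) :
    ContMDiffAt 𝓘(ℝ, E) 𝓘(ℝ, ℂ) ∞
      (fun y => (⟪(s y : H), (s y : H)⟫_ℂ)⁻¹ * ⟪(s y : H), f y⟫_ℂ) x := by
  have h : ContDiffAt ℝ ∞ (fun p : H × H => (⟪p.1, p.1⟫_ℂ)⁻¹ * ⟪p.1, p.2⟫_ℂ) ((s x : H), f x) := by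
    have h₁ : ContDiffAt ℝ ∞ (fun p : H × H => p.1) ((s x : H), f x) := contDiffAt_fst
    exact ((h₁.inner ℂ h₁).inv (inner_self_ne (hs.coe_ne_zero hx))).mul (h₁.inner ℂ contDiffAt_snd)
  exact h.contMDiffAt.comp x ((hs.contMDiffAt hx).prodMk_space hf)

/-- In d(cs) = c ds + dc s the last term is along s, and the projection kills it. -/
lemma exists_hderiv_eq (hs : IsFrame (E := E) K U s) (ht : IsFrame (E := E) K V t) (hx : x ∈ U)
    (hx' : x ∈ V) : ∃ c : ℂ, c ≠ 0 ∧ (t x : H) = c • (s x : H) ∧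
      ∀ u : TangentSpace 𝓘(ℝ, E) x, hderiv t x u = c • hderiv s x u := by
  let c : M → ℂ := fun y => (⟪(s y : H), (s y : H)⟫_ℂ)⁻¹ * ⟪(s y : H), (t y : H)⟫_ℂ
  have hct : ∀ y ∈ U, (t y : H) = c y • (s y : H) := fun y hy => hs.exists_smul hy (t y)
  have hc₀ : c x ≠ 0 := fun h => ht.coe_ne_zero hx' (by rw [hct x hx, h, zero_smul])
  refine ⟨c x, hc₀, hct x hx, fun u => ?_⟩
  have hc : MDifferentiableAt 𝓘(ℝ, E) 𝓘(ℝ, ℂ) c x :=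
    (hs.contMDiffAt_coeff hx (ht.contMDiffAt hx')).mdifferentiableAt (by simp)
  have h₁ : vderiv (E := E) (fun y => (t y : H)) x = vderiv (fun y => c y • (s y : H)) x := by
    apply Filter.EventuallyEq.mfderiv_eq
    filter_upwards [hs.isOpen.mem_nhds hx] with y hy using hct y hy
  rw [hderiv_apply, hderiv_apply, h₁, vderiv_smul hc (hs.mdifferentiableAt hx), hct x hx,
    horiz_smul_left hc₀, map_add, map_smul, map_smul, horiz_self (hs.coe_ne_zero hx), smul_zero,
    add_zero]

end IsFrame

end Frames

/-! ### The curvature form expressed by the Hermitian form of a frame -/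

section Curvature

open Filter

variable {E : Type*} [NormedAddCommGroup E] [NormedSpace ℝ E]
  {M : Type*} [TopologicalSpace M] [ChartedSpace E M]
  {H : Type*} [NormedAddCommGroup H] [InnerProductSpace ℂ H] {K : M → ℙ ℂ H}

/-- The value on real vectors of the Hermitian form defined by a frame. -/
def frameHerm (s : (x : M) → (K x).submodule) (x : M) (u v : TangentSpace 𝓘(ℝ, E) x) : ℂ :=
  ⟪hderiv s x u, hderiv s x v⟫_ℂ / ⟪(s x : H), (s x : H)⟫_ℂ

lemma frameHerm_conj (s : (x : M) → (K x).submodule) (x : M) (u v : TangentSpace 𝓘(ℝ, E) x) :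
    starRingEnd ℂ (frameHerm s x u v) = frameHerm s x v u := by
  simp [frameHerm]

variable {U V : Set M} {s t : (x : M) → (K x).submodule} {x : M}

/-- Numerator and denominator both acquire the factor |c|². -/
lemma IsFrame.frameHerm_eq (hs : IsFrame (E := E) K U s) (ht : IsFrame (E := E) K V t) (hx : x ∈ U)
    (hx' : x ∈ V) (u v : TangentSpace 𝓘(ℝ, E) x) : frameHerm t x u v = frameHerm s x u v := by
  obtain ⟨c, hc, h, h'⟩ := hs.exists_hderiv_eq ht hx hx'
  have hc' : (starRingEnd ℂ) c ≠ 0 := by simpa using hc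
  have := inner_self_ne (hs.coe_ne_zero hx)
  simp only [frameHerm, h, h', inner_smul_left, inner_smul_right]
  field_simp

variable [IsManifold 𝓘(ℝ, E) ∞ M]

omit [IsManifold 𝓘(ℝ, E) ∞ M] in
lemma IsFrame.eventually_chart (hs : IsFrame (E := E) K U s) {x₀ : M}
    (hx₀ : x ∈ (chartAt E x₀).source) (hx : x ∈ U) :
    ∀ᶠ y in 𝓝 (chartAt E x₀ x), y ∈ (chartAt E x₀).target ∧ (chartAt E x₀).symm y ∈ U := by
  have h₁ := (chartAt E x₀).open_target.mem_nhds ((chartAt E x₀).map_source hx₀)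
  have h₂ : Tendsto (chartAt E x₀).symm (𝓝 (chartAt E x₀ x)) (𝓝 x) := by
    have := (chartAt E x₀).continuousAt_symm ((chartAt E x₀).map_source hx₀)
    rwa [ContinuousAt, (chartAt E x₀).left_inv hx₀] at this
  filter_upwards [h₁, h₂ (hs.isOpen.mem_nhds hx)] with y hy hy' using ⟨hy, hy'⟩

/-- The frame in the preferred chart at `x₀`. -/
abbrev chartFrame (s : (x : M) → (K x).submodule) (x₀ : M) : E → H :=
  (fun y => (s y : H)) ∘ (chartAt E x₀).symm

omit [IsManifold 𝓘(ℝ, E) ∞ M] in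
lemma Form.inChart_apply {F : Type*} [NormedAddCommGroup F] [NormedSpace ℝ F] {n : ℕ}
    (θ : Form E M F n) (x₀ : M) (y : E) (v : Fin n → E) (hy : y ∈ (chartAt E x₀).target) :
    θ.inChart x₀ y v = θ ((chartAt E x₀).symm y) (fun i => coordFrame x₀ ((chartAt E x₀).symm y) (v i)) := by
  have h : ∀ w : E, (mfderiv 𝓘(ℝ, E) 𝓘(ℝ, E) (extChartAt 𝓘(ℝ, E) x₀).symm y :
      E →L[ℝ] TangentSpace 𝓘(ℝ, E) ((extChartAt 𝓘(ℝ, E) x₀).symm y)) w =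
      coordFrame x₀ ((chartAt E x₀).symm y) w := by
    intro w
    have h₁ : extChartAt 𝓘(ℝ, E) x₀ ((chartAt E x₀).symm y) = y := by
      simp [(chartAt E x₀).right_inv hy]
    simp only [coordFrame, modelWithCornersSelf_coe, range_id, mfderivWithin_univ]
    rw [h₁]
    rfl
  have h' : θ.inChart x₀ y v = θ ((chartAt E x₀).symm y) (fun i => (mfderiv 𝓘(ℝ, E) 𝓘(ℝ, E)
    (extChartAt 𝓘(ℝ, E) x₀).symm y : E →L[ℝ] TangentSpace 𝓘(ℝ, E)
      ((extChartAt 𝓘(ℝ, E) x₀).symm y)) (v i)) := rfl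
  rw [h']
  congr 1
  funext i
  exact h (v i)

lemma IsFrame.hderiv_coordFrame (hs : IsFrame (E := E) K U s) {x₀ : M}
    (hx₀ : x ∈ (chartAt E x₀).source) (hx : x ∈ U) (u : E) :
    hderiv s x (coordFrame x₀ x u) =
      horiz (s x : H) (fderiv ℝ (chartFrame (E := E) s x₀) (chartAt E x₀ x) u) := by
  rw [hderiv_apply, ← vderiv_comp_coordFrame hx₀ (hs.mdifferentiableAt hx)]
  rfl

lemma IsFrame.inChart_connForm₁ (hs : IsFrame (E := E) K U s) {x₀ : M}
    (hx₀ : x ∈ (chartAt E x₀).source) (hx : x ∈ U) :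
    (connForm₁ (E := E) K s).inChart x₀ =ᶠ[𝓝 (chartAt E x₀ x)] fun y =>
      ContinuousAlternatingMap.ofSubsingleton ℝ E ℂ (0 : Fin 1)
        (flatConn (chartFrame (E := E) s x₀) y) := by
  filter_upwards [hs.eventually_chart hx₀ hx] with y ⟨hy, hy'⟩
  ext v
  rw [Form.inChart_apply _ _ _ _ hy]
  have h₁ := vderiv_comp_coordFrame ((chartAt E x₀).map_target hy) (hs.mdifferentiableAt hy')
  have h₂ := DFunLike.congr_fun h₁ (v 0)
  rw [(chartAt E x₀).right_inv hy] at h₂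
  have h₃ : (ContinuousAlternatingMap.ofSubsingleton ℝ E ℂ (0 : Fin 1)
        (flatConn (chartFrame (E := E) s x₀) y)) v = flatConn (chartFrame (E := E) s x₀) y (v 0) := rfl
  rw [h₃, flatConn_apply, ← h₂]
  rfl

lemma IsFrame.contDiffAt_chartFrame (hs : IsFrame (E := E) K U s) {x₀ : M}
    (hx₀ : x ∈ (chartAt E x₀).source) (hx : x ∈ U) :
    ContDiffAt ℝ ∞ (chartFrame (E := E) s x₀) (chartAt E x₀ x) :=
  contDiffAt_comp_chart_symm hx₀ (hs.contMDiffAt hx)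

omit [NormedSpace ℝ E] [IsManifold 𝓘(ℝ, E) ∞ M] in
lemma IsFrame.chartFrame_apply {x₀ : M} (hx₀ : x ∈ (chartAt E x₀).source) :
    chartFrame (E := E) s x₀ (chartAt E x₀ x) = s x := by
  simp only [chartFrame, Function.comp_apply]
  rw [(chartAt E x₀).left_inv hx₀]

lemma IsFrame.fderiv_flatConn_chartFrame (hs : IsFrame (E := E) K U s) {x₀ : M}
    (hx₀ : x ∈ (chartAt E x₀).source) (hx : x ∈ U) (u v : E) :
    fderiv ℝ (flatConn (chartFrame (E := E) s x₀)) (chartAt E x₀ x) u v -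
      fderiv ℝ (flatConn (chartFrame (E := E) s x₀)) (chartAt E x₀ x) v u =
      frameHerm s x (coordFrame x₀ x u) (coordFrame x₀ x v) -
        frameHerm s x (coordFrame x₀ x v) (coordFrame x₀ x u) := by
  have h₀ : chartFrame (E := E) s x₀ (chartAt E x₀ x) = s x := IsFrame.chartFrame_apply hx₀
  have h₁ : chartFrame (E := E) s x₀ (chartAt E x₀ x) ≠ 0 := by
    rw [h₀]; exact hs.coe_ne_zero hx
  rw [fderiv_flatConn_sub (hs.contDiffAt_chartFrame hx₀ hx) h₁, h₀]
  simp only [frameHerm, hs.hderiv_coordFrame hx₀ hx]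
  ring

lemma IsFrame.connForm₁_d (hs : IsFrame (E := E) K U s) (hx : x ∈ U)
    (u v : TangentSpace 𝓘(ℝ, E) x) :
    (connForm₁ (E := E) K s).d x ![u, v] = frameHerm s x u v - frameHerm s x v u := by
  have h₀ := mem_chart_source E x
  have h₁ : (connForm₁ (E := E) K s).d x ![u, v] =
      extDeriv ((connForm₁ (E := E) K s).inChart x) (chartAt E x x) ![coordMap x x u, coordMap x x v] := by
    change extDeriv ((connForm₁ (E := E) K s).inChart x) (chartAt E x x)
      (fun i => coordMap x x (![u, v] i)) = _
    congr 1
    funext i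
    fin_cases i <;> rfl
  have h₂ : DifferentiableAt ℝ (flatConn (chartFrame (E := E) s x)) (chartAt E x x) := by
    refine (contDiffAt_flatConn (hs.contDiffAt_chartFrame h₀ hx) ?_).differentiableAt (by simp)
    rw [IsFrame.chartFrame_apply h₀]
    exact hs.coe_ne_zero hx
  rw [h₁, (hs.inChart_connForm₁ h₀ hx).extDeriv_eq, extDeriv_ofSubsingleton h₂,
    hs.fderiv_flatConn_chartFrame h₀ hx, coordFrame_coordMap h₀, coordFrame_coordMap h₀]

lemma IsFrame.curvForm_eq (hs : IsFrame (E := E) K U s) (hx : x ∈ U)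
    (u v : TangentSpace 𝓘(ℝ, E) x) :
    curvForm K x ![u, v] = Complex.I * (frameHerm s x u v - frameHerm s x v u) := by
  have hK : ∃ s, ∃ U, IsFrame (E := E) K U s ∧ x ∈ U := ⟨s, U, hs, hx⟩
  have hK' : ∃ U, IsFrame (E := E) K U (frameAt (E := E) K x) ∧ x ∈ U := by
    rw [frameAt, dif_pos hK]
    exact hK.choose_spec
  obtain ⟨V, ht, hx'⟩ := hK'
  rw [← hs.frameHerm_eq ht hx hx', ← hs.frameHerm_eq ht hx hx', ← ht.connForm₁_d hx']
  rfl

/-- The imaginary part of the Hermitian form in a chart is the exterior derivative of a real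
one-form. -/
lemma IsFrame.form_d_eq_zero (hs : IsFrame (E := E) K U s) (hx : x ∈ U) {β : Form E M ℝ 2}
    (hβ : ∀ y, ∀ u v : TangentSpace 𝓘(ℝ, E) y, (β y ![u, v] : ℂ) = curvForm K y ![u, v]) :
    β.d x = 0 := by
  have h₀ := mem_chart_source E x
  -- `L` is z ↦ Re(iz). Since the values of `β` are those of i dΘ, applying `L` to Θ gives a real
  -- potential η of `β` near x, and d(dη) = 0.
  let L : ℂ →L[ℝ] ℝ := Complex.reCLM.comp ((Complex.I • ContinuousLinearMap.id ℂ ℂ).restrictScalars ℝ)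
  have hL (z : ℂ) : L z = (Complex.I * z).re := by simp [L]
  let η : E → E →L[ℝ] ℝ := fun y => L.comp (flatConn (chartFrame (E := E) s x) y)
  have hη (y : M) (hy₀ : y ∈ (chartAt E x).source) (hy : y ∈ U) :
      ContDiffAt ℝ ∞ η (chartAt E x y) := by
    refine contDiffAt_const.clm_comp (contDiffAt_flatConn (hs.contDiffAt_chartFrame hy₀ hy) ?_)
    rw [IsFrame.chartFrame_apply hy₀]
    exact hs.coe_ne_zero hy
  have hη' (y : M) (hy₀ : y ∈ (chartAt E x).source) (hy : y ∈ U) (u v : E) :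
      fderiv ℝ η (chartAt E x y) u v = L (fderiv ℝ (flatConn (chartFrame (E := E) s x)) (chartAt E x y) u v) := by
    have h₁ : DifferentiableAt ℝ (flatConn (chartFrame (E := E) s x)) (chartAt E x y) := by
      refine (contDiffAt_flatConn (hs.contDiffAt_chartFrame hy₀ hy) ?_).differentiableAt (by simp)
      rw [IsFrame.chartFrame_apply hy₀]
      exact hs.coe_ne_zero hy
    have h₂ : HasFDerivAt η _ (chartAt E x y) :=
      ((ContinuousLinearMap.compL ℝ E ℂ ℝ L).hasFDerivAt.comp (chartAt E x y) h₁.hasFDerivAt)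
    rw [h₂.fderiv]
    rfl
  have key : β.inChart x =ᶠ[𝓝 (chartAt E x x)]
      extDeriv (fun y => ContinuousAlternatingMap.ofSubsingleton ℝ E ℝ (0 : Fin 1) (η y)) := by
    filter_upwards [hs.eventually_chart h₀ hx] with y ⟨hy, hy'⟩
    have hy₀ := (chartAt E x).map_target hy
    have hyy := (chartAt E x).right_inv hy
    ext v
    have hv : v = ![v 0, v 1] := by
      funext i
      fin_cases i <;> rfl
    have h₃ := extDeriv_ofSubsingleton (((hη _ hy₀ hy').differentiableAt (by simp))) (v 0) (v 1)
    rw [hη' _ hy₀ hy', hη' _ hy₀ hy', ← map_sub, hs.fderiv_flatConn_chartFrame hy₀ hy', hL,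
      ← hs.curvForm_eq hy', ← hβ, Complex.ofReal_re, hyy, ← hv] at h₃
    rw [h₃, Form.inChart_apply _ _ _ _ hy]
    congr 1
    funext i
    fin_cases i <;> rfl
  have h₄ : extDeriv (β.inChart x) (chartAt E x x) = 0 := by
    rw [key.extDeriv_eq]
    exact extDeriv_extDeriv_apply (contDiffAt_ofSubsingleton (hη x h₀ hx)) two_le_smooth
  ext v
  have h₅ : β.d x v = extDeriv (β.inChart x) (chartAt E x x) (fun i => coordMap x x (v i)) := rfl
  rw [h₅, h₄]
  rfl

end Curvature

/-! ### The differential of the map into projective space -/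

section Projective

variable {E : Type*} [NormedAddCommGroup E] [NormedSpace ℝ E]
  {M : Type*} [TopologicalSpace M] [ChartedSpace E M]
  {H : Type*} [NormedAddCommGroup H] [InnerProductSpace ℂ H] {K : M → ℙ ℂ H}
  {U : Set M} {s : (x : M) → (K x).submodule} {x : M}

lemma projDeriv_apply (hs : IsFrame (E := E) K U (frameAt (E := E) K x)) (hx : x ∈ U)
    (u : TangentSpace 𝓘(ℝ, E) x) (w : (K x).submodule) :
    (projDeriv K x u w : H) = ((⟪(frameAt (E := E) K x x : H), (frameAt (E := E) K x x : H)⟫_ℂ)⁻¹ *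
      ⟪(frameAt (E := E) K x x : H), (w : H)⟫_ℂ) • hderiv (frameAt (E := E) K x) x u := by
  set s := frameAt (E := E) K x
  have h : ((K x).submoduleᗮ.orthogonalProjectionOnto (vderiv (fun y => (s y : H)) x u) : H) =
      hderiv s x u := by
    rw [Submodule.coe_orthogonalProjectionOnto_apply, hderiv_apply]
    refine (Submodule.eq_starProjection_of_mem_orthogonal' (z :=
      ((⟪(s x : H), (s x : H)⟫_ℂ)⁻¹ * ⟪(s x : H), vderiv (fun y => (s y : H)) x u⟫_ℂ) • (s x : H))
      ?_ ?_ ?_)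
    · rw [Submodule.mem_orthogonal]
      intro w hw
      have hw' : w = _ := hs.exists_smul hx ⟨w, hw⟩
      rw [hw', inner_smul_left, inner_horiz_right (hs.coe_ne_zero hx), mul_zero]
    · exact Submodule.le_orthogonal_orthogonal _ (Submodule.smul_mem _ _ (s x).2)
    · rw [horiz_apply, sub_add_cancel]
  have h' : (projDeriv K x u w : H) = (⟪(s x : H), (s x : H)⟫_ℂ)⁻¹ • ⟪(s x : H), (w : H)⟫_ℂ •
      ((K x).submoduleᗮ.orthogonalProjectionOnto (vderiv (fun y => (s y : H)) x u) : H) := rfl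
  rw [h', h, smul_smul]

/-- `fsHerm` is evaluated on the representative of the line, a multiple c of the frame vector; the
factors |c|² cancel. -/
lemma IsFrame.fsHerm_projDeriv (hs : IsFrame (E := E) K U s) (hx : x ∈ U)
    (u v : TangentSpace 𝓘(ℝ, E) x) :
    fsHerm (projDeriv K x u) (projDeriv K x v) = frameHerm s x u v := by
  have hK : ∃ s, ∃ U, IsFrame (E := E) K U s ∧ x ∈ U := ⟨s, U, hs, hx⟩
  have hK' : ∃ U, IsFrame (E := E) K U (frameAt (E := E) K x) ∧ x ∈ U := by
    rw [frameAt, dif_pos hK]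
    exact hK.choose_spec
  obtain ⟨V, ht, hx'⟩ := hK'
  rw [← hs.frameHerm_eq ht hx hx']
  have h₀ := inner_self_ne (ht.coe_ne_zero hx')
  have h₁ : (lineVec (K x) : H) ≠ 0 := (K x).rep_nonzero
  have h₂ := ht.exists_smul hx' (lineVec (K x))
  set c := (⟪(frameAt (E := E) K x x : H), (frameAt (E := E) K x x : H)⟫_ℂ)⁻¹ *
      ⟪(frameAt (E := E) K x x : H), (lineVec (K x) : H)⟫_ℂ with hc
  have hc₀ : c ≠ 0 := by
    intro h
    rw [h, zero_smul] at h₂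
    exact h₁ h₂
  have hc' : (starRingEnd ℂ) c ≠ 0 := by simpa using hc₀
  rw [fsHerm, projDeriv_apply ht hx', projDeriv_apply ht hx', ← hc, h₂, frameHerm]
  simp only [inner_smul_left, inner_smul_right]
  field_simp

lemma projDeriv_injective_iff (hs : IsFrame (E := E) K U s) (hx : x ∈ U)
    (h : ∀ u : TangentSpace 𝓘(ℝ, E) x, hderiv s x u = 0 → u = 0) :
    Function.Injective (projDeriv (E := E) K x) := by
  intro u v huv
  have h₁ (w : TangentSpace 𝓘(ℝ, E) x) : frameHerm s x u w = frameHerm s x v w := by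
    rw [← hs.fsHerm_projDeriv hx, ← hs.fsHerm_projDeriv hx, huv]
  have h₀ := inner_self_ne (hs.coe_ne_zero hx)
  have h₂ : ⟪hderiv s x (u - v), hderiv s x (u - v)⟫_ℂ = 0 := by
    rw [map_sub (hderiv s x) u v, inner_sub_left, ← map_sub, sub_eq_zero]
    have := h₁ (u - v)
    exact (div_left_inj' h₀).1 this
  exact sub_eq_zero.1 (h _ (inner_self_eq_zero.1 h₂))

end Projective

/-! ### The complex structure and the pointwise properties of P -/

section Pointwise

open Filter

variable {E : Type*} [NormedAddCommGroup E] [NormedSpace ℝ E]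
  {M : Type*} [TopologicalSpace M] [ChartedSpace E M] [IsManifold 𝓘(ℝ, E) ∞ M]
  {H : Type*} [NormedAddCommGroup H] [InnerProductSpace ℂ H] {K : M → ℙ ℂ H} {N : ℕ}
  {U : Set M} {s : (x : M) → (K x).submodule} {x : M}

/-- The complex bilinear extension of ⟨Du|Dv⟩ has to conjugate the vector in the antilinear slot.
Hence a vector Z with D(conj Z) = 0 kills one of the two terms. -/
lemma IsFrame.extC₂_curvForm (hs : IsFrame (E := E) K U s) (hx : x ∈ U) (Z W : CTangent E x) :
    extC₂ (curvForm K x) Z W = Complex.I *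
      ((⟪extC (hderiv s x) (conjT Z), extC (hderiv s x) W⟫_ℂ -
        ⟪extC (hderiv s x) (conjT W), extC (hderiv s x) Z⟫_ℂ) / ⟪(s x : H), (s x : H)⟫_ℂ) := by
  simp only [extC₂, hs.curvForm_eq hx, extC, reT_conjT, imT_conjT, map_neg, smul_neg, frameHerm,
    inner_add_left, inner_add_right, inner_neg_left, inner_smul_left, inner_smul_right, Complex.conj_I]
  ring_nf
  simp only [Complex.I_sq, show Complex.I ^ 3 = -Complex.I by
    rw [pow_succ, Complex.I_sq, neg_one_mul]]
  ring

lemma IsFrame.distribution_le (hs : IsFrame (E := E) K U s) (hx : x ∈ U) :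
    distribution (E := E) K x ≤ conjKer (hderiv (E := E) s x) := by
  refine Submodule.span_le.2 ?_
  rintro Z ⟨X, -, hX, rfl⟩
  refine mem_conjKer_iff.2 ?_
  -- The covariant derivatives vanish for all v, in particular for v = D(conj Z), where they give
  -- its squared norm.
  refine inner_self_eq_zero (𝕜 := ℂ).1 ?_
  rw [← hs.covDeriv_eq hx]
  exact hX _ U s hs x hx

omit [IsManifold 𝓘(ℝ, E) ∞ M] in
-- Write l I(s x) = I(w). Differentiating both covariantly along Z, the Leibniz rule leaves (Zl) I(s
-- x) = 0 at x, where the component of I(s x) is ⟨s x|s x⟩ ≠ 0.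
lemma IsFrame.extC_vderiv_multiplier (hs : IsFrame (E := E) K U s) (hx : x ∈ U) {l : M → ℂ}
    (hl : l ∈ multipliers (E := E) K) {Z : CTangent E x} (hZ : Z ∈ conjKer (hderiv (E := E) s x)) :
    extC (vderiv l x) Z = 0 := by
  obtain ⟨w, hw⟩ := hl.2 (s x : H)
  have hl' : MDifferentiableAt 𝓘(ℝ, E) 𝓘(ℝ, ℂ) l x := hl.1.mdifferentiableAt (by simp)
  have h₀ (v : H) : covDeriv K s (vecSection K v) x Z = 0 := by
    rw [hs.covDeriv_eq hx, mem_conjKer_iff.1 hZ, inner_zero_left]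
  have hw' (y : M) : vecSection K w y (s y) = l y • vecSection K (s x : H) y (s y) := by
    rw [← hw y]; rfl
  have hm : MDifferentiableAt 𝓘(ℝ, E) 𝓘(ℝ, ℂ) (fun y => vecSection K (s x : H) y (s y)) x := by
    let L : H →L[ℝ] H →L[ℝ] ℂ := (isBoundedBilinearMap_inner (𝕜 := ℂ) (E := H)).toContinuousLinearMap
    exact ((L.flip (s x : H)).differentiableAt.mdifferentiableAt (x := (s x : H))).comp x
      (hs.mdifferentiableAt hx)
  have h₁ := h₀ w
  have h₂ := h₀ (s x : H)
  simp only [covDeriv, hw', extC, vderiv_smul hl' hm] at h₁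
  have h₃ : vecSection K (s x : H) x (s x) = ⟪(s x : H), (s x : H)⟫_ℂ := rfl
  rw [covDeriv, extC] at h₂
  have h₄ : extC (vderiv l x) Z * vecSection K (s x : H) x (s x) = 0 := by
    simp only [extC, smul_eq_mul] at h₁ h₂ ⊢
    linear_combination h₁ - l x * h₂
  exact (mul_eq_zero.1 h₄).resolve_right (by rw [h₃]; exact inner_self_ne (hs.coe_ne_zero hx))

namespace IsCoherentStateMap

variable (hK : IsCoherentStateMap (E := E) K N)
include hK

/-- The form ω depends on its arguments only through D, so the kernel of D lies in the radical of ω.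
-/
lemma hderiv_injective (hs : IsFrame (E := E) K U s) (hx : x ∈ U) :
    Function.Injective (hderiv (E := E) s x) := by
  rw [injective_iff_map_eq_zero]
  intro u hu
  refine hK.nondegenerate x u fun v => ?_
  rw [hs.curvForm_eq hx]
  simp [frameHerm, hu]

variable [FiniteDimensional ℝ E]

/-- Injectivity of D bounds the dimension of `conjKer` by N, which is already the rank of the
distribution contained in it. -/
lemma distribution_eq (hs : IsFrame (E := E) K U s) (hx : x ∈ U) :
    distribution (E := E) K x = conjKer (hderiv (E := E) s x) := by
  have : FiniteDimensional ℝ (TangentSpace 𝓘(ℝ, E) x) := inferInstanceAs (FiniteDimensional ℝ E)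
  have h₁ := finrank_conjKer_le (hK.hderiv_injective hs hx)
  have h₂ : finrank ℝ (TangentSpace 𝓘(ℝ, E) x) = 2 * N := hK.dim_eq
  have h₃ := hK.maximal x
  have h₄ : finrank ℂ (conjKer (hderiv (E := E) s x)) ≤ N := by omega
  exact Submodule.eq_of_le_of_finrank_le (hs.distribution_le hx) (h₄.trans h₃.ge)

/-- There is an almost complex structure for which the horizontal differentials of all frames are
complex linear. -/
lemma exists_complexStructure :
    ∃ J : (x : M) → TangentSpace 𝓘(ℝ, E) x →L[ℝ] TangentSpace 𝓘(ℝ, E) x,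
      ∀ (U : Set M) (s : (x : M) → (K x).submodule), IsFrame (E := E) K U s → ∀ x ∈ U,
        ∀ u, hderiv s x (J x u) = Complex.I • hderiv (E := E) s x u := by
  have key (x : M) : ∃ J : TangentSpace 𝓘(ℝ, E) x →L[ℝ] TangentSpace 𝓘(ℝ, E) x,
      ∀ (U : Set M) (s : (x : M) → (K x).submodule), IsFrame (E := E) K U s → x ∈ U →
        ∀ u, hderiv s x (J u) = Complex.I • hderiv (E := E) s x u := by
    have : FiniteDimensional ℝ (TangentSpace 𝓘(ℝ, E) x) := inferInstanceAs (FiniteDimensional ℝ E)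
    obtain ⟨U, s, hs, hx⟩ := hK.smooth x
    have hD := hK.hderiv_injective hs hx
    have h₂ : finrank ℝ (TangentSpace 𝓘(ℝ, E) x) = 2 * N := hK.dim_eq
    have h₃ := hK.maximal x
    rw [hK.distribution_eq hs hx] at h₃
    -- `f` is D⁻¹ i D; its linearity follows after applying the injective D.
    choose f hf using exists_I_smul_of_finrank_conjKer hD (by rw [h₂, h₃])
    let F : TangentSpace 𝓘(ℝ, E) x →ₗ[ℝ] TangentSpace 𝓘(ℝ, E) x :=
      { toFun := f
        map_add' := fun u v => hD (by
          rw [hf]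
          rw [map_add, map_add, hf, hf, smul_add])
        map_smul' := fun r u => hD (by
          rw [hf]
          rw [RingHom.id_apply, map_smul, map_smul, hf, smul_comm]) }
    have : T2Space (TangentSpace 𝓘(ℝ, E) x) := inferInstanceAs (T2Space E)
    refine ⟨LinearMap.toContinuousLinearMap F, fun V t ht hx' u => ?_⟩
    -- For another frame D changes by a scalar, which commutes with i, so the same `J` serves.
    obtain ⟨c, -, -, h⟩ := hs.exists_hderiv_eq ht hx hx'
    rw [h, h, smul_comm]
    exact congrArg _ (hf u)
  choose J hJ using key
  exact ⟨J, fun U s hs x hx => hJ x U s hs hx⟩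

end IsCoherentStateMap

/-- The almost complex structure on a manifold endowed with a coherent state map. -/
def IsCoherentStateMap.J [FiniteDimensional ℝ E] (hK : IsCoherentStateMap (E := E) K N) (x : M) :
    TangentSpace 𝓘(ℝ, E) x →L[ℝ] TangentSpace 𝓘(ℝ, E) x :=
  hK.exists_complexStructure.choose x

namespace IsCoherentStateMap

variable [FiniteDimensional ℝ E] (hK : IsCoherentStateMap (E := E) K N)
include hK

lemma hderiv_J (hs : IsFrame (E := E) K U s) (hx : x ∈ U) (u : TangentSpace 𝓘(ℝ, E) x) :
    hderiv s x (hK.J x u) = Complex.I • hderiv (E := E) s x u :=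
  hK.exists_complexStructure.choose_spec U s hs x hx u

lemma J_J (x : M) (u : TangentSpace 𝓘(ℝ, E) x) : hK.J x (hK.J x u) = -u := by
  obtain ⟨U, s, hs, hx⟩ := hK.smooth x
  apply hK.hderiv_injective hs hx
  rw [hK.hderiv_J hs hx, hK.hderiv_J hs hx, I_smul_I_smul, map_neg]

lemma mem_distribution_iff {Z : CTangent E x} :
    Z ∈ distribution (E := E) K x ↔ imT Z = -hK.J x (reT Z) := by
  obtain ⟨U, s, hs, hx⟩ := hK.smooth x
  rw [hK.distribution_eq hs hx, mem_conjKer, ← hK.hderiv_J hs hx,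
    (hK.hderiv_injective hs hx).eq_iff]
  constructor
  · intro h
    rw [h, hK.J_J, neg_neg]
  · intro h
    rw [h, map_neg, hK.J_J, neg_neg]

lemma mkT_mem_distribution (u : TangentSpace 𝓘(ℝ, E) x) :
    mkT u (-hK.J x u) ∈ distribution (E := E) K x :=
  hK.mem_distribution_iff.2 (by simp)

omit [FiniteDimensional ℝ E] in
lemma extC_multiplier_eq_zero {l : M → ℂ} (hl : l ∈ multipliers (E := E) K) {Z : CTangent E x}
    (hZ : Z ∈ distribution (E := E) K x) : extC (vderiv l x) Z = 0 := by
  obtain ⟨U, s, hs, hx⟩ := hK.smooth x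
  exact hs.extC_vderiv_multiplier hx hl (hs.distribution_le hx hZ)

/-- Multipliers are antiholomorphic: their differentials vanish on u - iJu. -/
lemma vderiv_multiplier_J {l : M → ℂ} (hl : l ∈ multipliers (E := E) K)
    (u : TangentSpace 𝓘(ℝ, E) x) : vderiv l x (hK.J x u) = -(Complex.I * vderiv l x u) := by
  have h := hK.extC_multiplier_eq_zero hl (hK.mkT_mem_distribution u)
  rw [extC_mkT, map_neg, smul_eq_mul] at h
  linear_combination Complex.I * h + (vderiv l x (hK.J x u)) * Complex.I_mul_I

/-- The common kernel of N independent forms in dimension 2N has dimension N and contains the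
distribution. -/
lemma mem_distribution_iff_of_linearIndependent {l : Fin N → M → ℂ}
    (hl : ∀ i, l i ∈ multipliers (E := E) K)
    (h : LinearIndependent ℂ (fun i => (vderiv (l i) x : TangentSpace 𝓘(ℝ, E) x →L[ℝ] ℂ)))
    (Z : CTangent E x) :
    Z ∈ distribution (E := E) K x ↔ ∀ i, extC (vderiv (l i) x) Z = 0 := by
  have : FiniteDimensional ℝ (TangentSpace 𝓘(ℝ, E) x) := inferInstanceAs (FiniteDimensional ℝ E)
  refine eq_ker_of_linearIndependent h (fun i Z hZ => hK.extC_multiplier_eq_zero (hl i) hZ) ?_ Z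
  have h₂ : finrank ℝ (TangentSpace 𝓘(ℝ, E) x) = 2 * N := hK.dim_eq
  rw [hK.maximal x, h₂, Fintype.card_fin, two_mul]

lemma isotropic {Z W : CTangent E x} (hZ : Z ∈ distribution (E := E) K x)
    (hW : W ∈ distribution (E := E) K x) : extC₂ (curvForm K x) Z W = 0 := by
  obtain ⟨U, s, hs, hx⟩ := hK.smooth x
  rw [hK.distribution_eq hs hx, mem_conjKer_iff] at hZ hW
  rw [hs.extC₂_curvForm hx, hZ, hW]
  simp

lemma transversal {Z : CTangent E x} (hZ : Z ∈ distribution (E := E) K x)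
    (hZ' : conjT Z ∈ distribution (E := E) K x) : Z = 0 := by
  obtain ⟨U, s, hs, hx⟩ := hK.smooth x
  rw [hK.distribution_eq hs hx] at hZ hZ'
  exact eq_zero_of_mem_conjKer (hK.hderiv_injective hs hx) hZ hZ'

/-- As D(conj Z) = 0, only ‖DZ‖²/‖s‖² survives, and DZ = 0 would put conj Z into the distribution,
against transversality. -/
lemma positive {Z : CTangent E x} (hZ : Z ∈ distribution (E := E) K x) (hZ₀ : Z ≠ 0) :
    0 < (Complex.I * extC₂ (curvForm K x) Z (conjT Z)).re ∧
      (Complex.I * extC₂ (curvForm K x) Z (conjT Z)).im = 0 := by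
  have hZ' : conjT Z ∉ distribution (E := E) K x := fun h => hZ₀ (hK.transversal hZ h)
  obtain ⟨U, s, hs, hx⟩ := hK.smooth x
  rw [hK.distribution_eq hs hx, mem_conjKer_iff] at hZ hZ'
  rw [conjT_conjT] at hZ'
  have h : Complex.I * extC₂ (curvForm K x) Z (conjT Z) =
      ((‖extC (hderiv s x) Z‖ ^ 2 / ‖(s x : H)‖ ^ 2 : ℝ) : ℂ) := by
    rw [hs.extC₂_curvForm hx, conjT_conjT, hZ, ← mul_assoc, Complex.I_mul_I]
    simp [inner_self_eq_norm_sq_to_K]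
    ring
  rw [h]
  refine ⟨?_, Complex.ofReal_im _⟩
  rw [Complex.ofReal_re]
  have h₁ := norm_pos_iff.2 hZ'
  have h₂ := norm_pos_iff.2 (hs.coe_ne_zero hx)
  positivity

/-- A complex vector which is orthogonal to the distribution lies in the distribution. -/
lemma mem_distribution_of_orthogonal {Z : CTangent E x}
    (hZ : ∀ W ∈ distribution (E := E) K x, extC₂ (curvForm K x) Z W = 0) :
    Z ∈ distribution (E := E) K x := by
  obtain ⟨U, s, hs, hx⟩ := hK.smooth x
  have h₀ : ∃ V ∈ distribution (E := E) K x,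
      extC (hderiv s x) V = extC (hderiv s x) (conjT Z) := by
    let u := reT Z
    let w := -imT Z
    have hu : mkT u w = conjT Z := rfl
    -- With conj Z = u + iw one has D(conj Z) = Dp for p = u + Jw, while D(p - iJp) = 2Dp. Pairing Z
    -- with this V gives a nonzero multiple of ‖D(conj Z)‖².
    refine ⟨(2⁻¹ : ℂ) • mkT (u + hK.J x w) (-hK.J x (u + hK.J x w)),
      Submodule.smul_mem _ _ (hK.mkT_mem_distribution _), ?_⟩
    rw [← hu, ← extCₗ_apply, map_smul, extCₗ_apply]
    simp only [extC_mkT, map_add, map_neg, hK.hderiv_J hs hx, hK.J_J, smul_add, smul_neg,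
      I_smul_I_smul]
    module
  obtain ⟨V, hV, hV'⟩ := h₀
  have h₁ := hZ V hV
  rw [hK.distribution_eq hs hx, mem_conjKer_iff] at hV
  rw [hs.extC₂_curvForm hx, hV, hV'] at h₁
  have h₂ := inner_self_ne (hs.coe_ne_zero hx)
  rw [hK.distribution_eq hs hx, mem_conjKer_iff]
  simpa [h₂, (hs.coe_ne_zero hx), hs.ne_zero x hx] using h₁

end IsCoherentStateMap

end Pointwise

/-! ### Smoothness of maps into spaces of linear and bilinear maps -/

section BilinearForms

open Filter

variable {H : Type*} [NormedAddCommGroup H] [InnerProductSpace ℂ H]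

variable (H) in
/-- The real bilinear map `(a, b) ↦ φ ⟪a, b⟫`. -/
def innerThrough (φ : ℂ →L[ℝ] ℝ) : H →L[ℝ] H →L[ℝ] ℝ :=
  (ContinuousLinearMap.compL ℝ H ℂ ℝ φ).comp
    (isBoundedBilinearMap_inner (𝕜 := ℂ) (E := H)).toContinuousLinearMap

variable {E : Type*} [NormedAddCommGroup E] [NormedSpace ℝ E] [FiniteDimensional ℝ E]

/-- As `E` is finite dimensional, a linear map on it amounts to its finitely many values on a basis.
-/
lemma contDiffAt_clm_of_apply {D F : Type*} [NormedAddCommGroup D] [NormedSpace ℝ D]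
    [NormedAddCommGroup F] [NormedSpace ℝ F] {n : WithTop ℕ∞} {f : D → E →L[ℝ] F} {y : D}
    (h : ∀ u, ContDiffAt ℝ n (fun z => f z u) y) : ContDiffAt ℝ n f y := by
  let d := finrank ℝ E
  have hd : d = finrank ℝ (Fin d → ℝ) := (finrank_fin_fun ℝ).symm
  let e₁ := ContinuousLinearEquiv.ofFinrankEq hd
  let e₂ := (e₁.arrowCongr (1 : F ≃L[ℝ] F)).trans (ContinuousLinearEquiv.piRing (Fin d))
  rw [← Function.id_comp f, ← e₂.symm_comp_self]
  exact e₂.symm.contDiff.contDiffAt.comp y (contDiffAt_pi.2 fun i => h _)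

lemma contDiffAt_bilin_of_apply {a : E → E →L[ℝ] E →L[ℝ] ℝ} {y : E}
    (h : ∀ u v, ContDiffAt ℝ ∞ (fun z => a z u v) y) : ContDiffAt ℝ ∞ a y :=
  contDiffAt_clm_of_apply fun u => contDiffAt_clm_of_apply fun v => h u v

omit [FiniteDimensional ℝ E] in
lemma contDiffAt_flatHerm (φ : ℂ →L[ℝ] ℝ) {s : E → H} {y : E} (hs : ContDiffAt ℝ ∞ s y)
    (h₀ : s y ≠ 0) (u v : E) :
    ContDiffAt ℝ ∞ (fun z => φ (⟪horiz (s z) (fderiv ℝ s z u), horiz (s z) (fderiv ℝ s z v)⟫_ℂ /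
      ⟪s z, s z⟫_ℂ)) y := by
  have h (w : E) : ContDiffAt ℝ ∞ (fun z => horiz (s z) (fderiv ℝ s z w)) y := by
    have hw : ContDiffAt ℝ ∞ (fun z => fderiv ℝ s z w) y :=
      (hs.fderiv_right (m := ∞) le_rfl).clm_apply contDiffAt_const
    simp only [horiz_apply]
    have hc : ContDiffAt ℝ ∞ (fun z => (⟪s z, s z⟫_ℂ)⁻¹ * ⟪s z, fderiv ℝ s z w⟫_ℂ) y :=
      ((hs.inner ℂ hs).inv (inner_self_ne h₀)).mul (hs.inner ℂ hw)
    exact hw.sub (hc.smul hs)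
  have hd : ContDiffAt ℝ ∞ (fun z => ⟪horiz (s z) (fderiv ℝ s z u), horiz (s z) (fderiv ℝ s z v)⟫_ℂ *
      (⟪s z, s z⟫_ℂ)⁻¹) y :=
    ((h u).inner ℂ (h v)).mul ((hs.inner ℂ hs).inv (inner_self_ne h₀))
  simp only [div_eq_mul_inv]
  exact φ.contDiff.contDiffAt.comp y hd

end BilinearForms

/-! ### Smoothness of the Hermitian form and of fields defined by duality -/

section Smoothness

open Filter

variable {E : Type*} [NormedAddCommGroup E] [NormedSpace ℝ E] [FiniteDimensional ℝ E]
  {M : Type*} [TopologicalSpace M] [ChartedSpace E M] [IsManifold 𝓘(ℝ, E) ∞ M]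
  {H : Type*} [NormedAddCommGroup H] [InnerProductSpace ℂ H] {K : M → ℙ ℂ H} {N : ℕ}
  {U : Set M} {s : (x : M) → (K x).submodule} {x : M}

variable (K) in
/-- The real bilinear form `φ ⟪D u, D v⟫ / ⟪s, s⟫` on the tangent spaces of `M`. -/
def hermForm (φ : ℂ →L[ℝ] ℝ) (x : M) :
    TangentSpace 𝓘(ℝ, E) x →L[ℝ] TangentSpace 𝓘(ℝ, E) x →L[ℝ] ℝ :=
  let s := frameAt (E := E) K x
  let D : E →L[ℝ] H := hderiv s x
  ((‖(s x : H)‖ ^ 2)⁻¹ • (innerThrough H φ).bilinearComp D D : E →L[ℝ] E →L[ℝ] ℝ)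

omit [FiniteDimensional ℝ E] [IsManifold 𝓘(ℝ, E) ∞ M] in
lemma hermForm_apply (hs : IsFrame (E := E) K U s) (hx : x ∈ U) (φ : ℂ →L[ℝ] ℝ)
    (u v : TangentSpace 𝓘(ℝ, E) x) : hermForm K φ x u v = φ (frameHerm s x u v) := by
  have hK : ∃ s, ∃ U, IsFrame (E := E) K U s ∧ x ∈ U := ⟨s, U, hs, hx⟩
  have hK' : ∃ U, IsFrame (E := E) K U (frameAt (E := E) K x) ∧ x ∈ U := by
    rw [frameAt, dif_pos hK]
    exact hK.choose_spec
  obtain ⟨V, ht, hx'⟩ := hK'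
  rw [← hs.frameHerm_eq ht hx hx', frameHerm]
  set t := frameAt (E := E) K x
  have h₁ : hermForm K φ x u v = (‖(t x : H)‖ ^ 2)⁻¹ * φ ⟪hderiv t x u, hderiv t x v⟫_ℂ := rfl
  have h₂ : ⟪hderiv t x u, hderiv t x v⟫_ℂ / ⟪(t x : H), (t x : H)⟫_ℂ =
      (‖(t x : H)‖ ^ 2)⁻¹ • ⟪hderiv t x u, hderiv t x v⟫_ℂ := by
    rw [inner_self_eq_norm_sq_to_K, Complex.real_smul, div_eq_inv_mul]
    simp
  rw [h₁, h₂, map_smul, smul_eq_mul]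

/-- A family of bilinear forms in the coordinates of the preferred chart at `x₀`. -/
def bilinInChart (b : (x : M) → TangentSpace 𝓘(ℝ, E) x →L[ℝ] TangentSpace 𝓘(ℝ, E) x →L[ℝ] ℝ)
    (x₀ x : M) : E →L[ℝ] E →L[ℝ] ℝ :=
  let B : E →L[ℝ] E →L[ℝ] ℝ := b x
  let c : E →L[ℝ] E := coordFrame x₀ x
  B.bilinearComp c c

omit [FiniteDimensional ℝ E] [IsManifold 𝓘(ℝ, E) ∞ M] in
lemma bilinInChart_apply
    (b : (x : M) → TangentSpace 𝓘(ℝ, E) x →L[ℝ] TangentSpace 𝓘(ℝ, E) x →L[ℝ] ℝ)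
    (x₀ x : M) (u v : E) :
    bilinInChart b x₀ x u v = b x (coordFrame x₀ x u) (coordFrame x₀ x v) := rfl

/-- `hermForm` uses a frame chosen separately at each point, with no continuity in the choice. Since
its value does not depend on the frame, one fixed smooth frame computes it near `x₀`. -/
lemma contMDiffAt_bilinInChart_hermForm (hK : SmoothMap (E := E) K) (φ : ℂ →L[ℝ] ℝ) (x₀ : M) :
    ContMDiffAt 𝓘(ℝ, E) 𝓘(ℝ, E →L[ℝ] E →L[ℝ] ℝ) ∞ (bilinInChart (hermForm (E := E) K φ) x₀) x₀ := by
  obtain ⟨U, s, hs, hx⟩ := hK x₀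
  have h₀ := mem_chart_source E x₀
  let a : E → E →L[ℝ] E →L[ℝ] ℝ := fun y => bilinInChart (hermForm K φ) x₀ ((chartAt E x₀).symm y)
  have ha : ContDiffAt ℝ ∞ a (chartAt E x₀ x₀) := by
    refine contDiffAt_bilin_of_apply fun u v => ?_
    have h₁ : chartFrame (E := E) s x₀ (chartAt E x₀ x₀) ≠ 0 := by
      rw [IsFrame.chartFrame_apply h₀]
      exact hs.coe_ne_zero hx
    refine (contDiffAt_flatHerm φ (hs.contDiffAt_chartFrame h₀ hx) h₁ u v).congr_of_eventuallyEq ?_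
    filter_upwards [hs.eventually_chart h₀ hx] with y ⟨hy, hy'⟩
    have hy₀ := (chartAt E x₀).map_target hy
    have h₂ (w : E) := hs.hderiv_coordFrame hy₀ hy' w
    rw [(chartAt E x₀).right_inv hy] at h₂
    simp only [a, bilinInChart_apply]
    rw [hermForm_apply hs hy', frameHerm, h₂, h₂]
    rfl
  have h₃ : ContMDiffAt 𝓘(ℝ, E) 𝓘(ℝ, E →L[ℝ] E →L[ℝ] ℝ) ∞ (fun x => a (chartAt E x₀ x)) x₀ :=
    ha.contMDiffAt.comp x₀ (contMDiffAt_chart_self x₀ h₀)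
  refine h₃.congr_of_eventuallyEq ?_
  filter_upwards [(chartAt E x₀).open_source.mem_nhds h₀] with x hx
  simp only [a]
  rw [(chartAt E x₀).left_inv hx]

/-- Vector fields defined by a smooth nondegenerate form and a smooth one-form are smooth. -/
lemma contMDiffAt_field_of_nondegenerate
    {b : (x : M) → TangentSpace 𝓘(ℝ, E) x →L[ℝ] TangentSpace 𝓘(ℝ, E) x →L[ℝ] ℝ} {x₀ : M}
    (hb : ContMDiffAt 𝓘(ℝ, E) 𝓘(ℝ, E →L[ℝ] E →L[ℝ] ℝ) ∞ (bilinInChart b x₀) x₀)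
    (hb' : ∀ x u, (∀ v, b x u v = 0) → u = 0) {α : (x : M) → TangentSpace 𝓘(ℝ, E) x →L[ℝ] ℝ}
    (hα : ContMDiffAt 𝓘(ℝ, E) 𝓘(ℝ, E →L[ℝ] ℝ) ∞
      (fun x => ((α x).comp (coordFrame x₀ x) : E →L[ℝ] ℝ)) x₀)
    {X : (x : M) → TangentSpace 𝓘(ℝ, E) x} (hX : ∀ x v, b x (X x) v = α x v) :
    ContMDiffAt 𝓘(ℝ, E) 𝓘(ℝ, E).tangent ∞
      (fun x => (⟨x, X x⟩ : TangentBundle 𝓘(ℝ, E) M)) x₀ := by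
  -- In the chart the form is an injective map from `E` to its dual, invertible by dimension. Since
  -- inversion is smooth, the field solving b(X, ·) = α is smooth.
  have hinv (x : M) (hx : x ∈ (chartAt E x₀).source) : (bilinInChart b x₀ x).IsInvertible := by
    have hinj : Function.Injective (bilinInChart b x₀ x) := by
      rw [injective_iff_map_eq_zero]
      intro u hu
      have : coordFrame x₀ x u = 0 := by
        refine hb' x _ fun v => ?_
        have h := DFunLike.congr_fun hu (coordMap x₀ x v)
        rw [bilinInChart_apply, coordFrame_coordMap hx] at h
        exact h
      rw [← coordMap_coordFrame hx u, this, map_zero]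
    have hfin : finrank ℝ E = finrank ℝ (E →L[ℝ] ℝ) := by
      rw [← (LinearMap.toContinuousLinearMap : (E →ₗ[ℝ] ℝ) ≃ₗ[ℝ] E →L[ℝ] ℝ).finrank_eq]
      exact (Subspace.dual_finrank_eq (K := ℝ) (V := E)).symm
    let e := (LinearEquiv.ofInjectiveOfFinrankEq (bilinInChart b x₀ x).toLinearMap hinj hfin).toContinuousLinearEquiv
    exact ⟨e, by ext; rfl⟩
  have h₀ := mem_chart_source E x₀
  have h₁ : ContMDiffAt 𝓘(ℝ, E) 𝓘(ℝ, E) ∞ (fun x =>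
      (bilinInChart b x₀ x).inverse ((α x).comp (coordFrame x₀ x) : E →L[ℝ] ℝ)) x₀ := by
    have h₂ : ContMDiffAt 𝓘(ℝ, E) 𝓘(ℝ, (E →L[ℝ] ℝ) →L[ℝ] E) ∞
        (fun x => (bilinInChart b x₀ x).inverse) x₀ :=
      ((hinv x₀ h₀).contDiffAt_map_inverse (n := ∞)).contMDiffAt.comp x₀ hb
    exact h₂.clm_apply hα
  refine contMDiffAt_field_of_coord h₁ ?_
  filter_upwards [(chartAt E x₀).open_source.mem_nhds h₀] with x hx
  have h₃ : bilinInChart b x₀ x (coordMap x₀ x (X x)) = ((α x).comp (coordFrame x₀ x) : E →L[ℝ] ℝ) := by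
    ext v
    rw [bilinInChart_apply, coordFrame_coordMap hx, hX]
    rfl
  rw [← h₃]
  obtain ⟨e, he⟩ := hinv x hx
  rw [← he, ContinuousLinearMap.inverse_equiv]
  simp

end Smoothness

/-! ### The metric and Hamiltonian vector fields -/

section Metric

open Filter

variable {E : Type*} [NormedAddCommGroup E] [NormedSpace ℝ E] [FiniteDimensional ℝ E]
  {M : Type*} [TopologicalSpace M] [ChartedSpace E M] [IsManifold 𝓘(ℝ, E) ∞ M]
  {H : Type*} [NormedAddCommGroup H] [InnerProductSpace ℂ H] {K : M → ℙ ℂ H} {N : ℕ}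
  {U : Set M} {s : (x : M) → (K x).submodule} {x : M}

omit [FiniteDimensional ℝ E] [IsManifold 𝓘(ℝ, E) ∞ M] in
lemma frameHerm_self_re (s : (x : M) → (K x).submodule) (x : M) (u : TangentSpace 𝓘(ℝ, E) x) :
    (frameHerm s x u u).re = ‖hderiv s x u‖ ^ 2 / ‖(s x : H)‖ ^ 2 := by
  have : frameHerm s x u u = ((‖hderiv s x u‖ ^ 2 / ‖(s x : H)‖ ^ 2 : ℝ) : ℂ) := by
    simp [frameHerm, inner_self_eq_norm_sq_to_K]
  rw [this, Complex.ofReal_re]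

lemma isVonNBounded_of_injective {F : Type*} [NormedAddCommGroup F] [NormedSpace ℝ F]
    (D : E →L[ℝ] F) (hD : Function.Injective D) {c : ℝ} (hc : 0 < c) :
    Bornology.IsVonNBounded ℝ {v : E | c * ‖D v‖ ^ 2 < 1} := by
  obtain ⟨k, hk, hk'⟩ := D.toLinearMap.exists_antilipschitzWith (LinearMap.ker_eq_bot.2 hD)
  refine (NormedSpace.isVonNBounded_closedBall ℝ E (k * (1 + c⁻¹))).subset ?_
  intro v hv
  have hv' : c * ‖D v‖ ^ 2 < 1 := hv
  have h₁ : ‖D v‖ ^ 2 < c⁻¹ := by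
    rw [inv_eq_one_div, lt_div_iff₀ hc, mul_comm]
    exact hv'
  have h₂ : ‖v‖ ≤ k * ‖D v‖ := by
    have := hk'.le_mul_dist v 0
    simpa using this
  -- A crude bound that avoids the square root: t ≤ 1 + t² for every real t.
  have h₃ : ‖D v‖ ≤ 1 + c⁻¹ := by nlinarith [norm_nonneg (D v)]
  rw [mem_closedBall_zero_iff]
  exact h₂.trans (by gcongr)

namespace IsCoherentStateMap

variable (hK : IsCoherentStateMap (E := E) K N)
include hK

omit [FiniteDimensional ℝ E] in
-- i(z - conj z) = -2 Im z; in particular ω is real valued.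
lemma curvForm_eq_hermForm (x : M) (u v : TangentSpace 𝓘(ℝ, E) x) :
    curvForm K x ![u, v] = (hermForm K ((-2 : ℝ) • Complex.imCLM) x u v : ℂ) := by
  obtain ⟨U, s, hs, hx⟩ := hK.smooth x
  rw [hermForm_apply hs hx, hs.curvForm_eq hx, ← frameHerm_conj s x u v]
  apply Complex.ext <;> simp
  ring

lemma frameHerm_J_right (hs : IsFrame (E := E) K U s) (hx : x ∈ U) (u v : TangentSpace 𝓘(ℝ, E) x) :
    frameHerm s x u (hK.J x v) = Complex.I * frameHerm s x u v := by
  rw [frameHerm, hK.hderiv_J hs hx, inner_smul_right, mul_div_assoc, frameHerm]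

lemma frameHerm_J_J (hs : IsFrame (E := E) K U s) (hx : x ∈ U) (u v : TangentSpace 𝓘(ℝ, E) x) :
    frameHerm s x (hK.J x u) (hK.J x v) = frameHerm s x u v := by
  rw [hK.frameHerm_J_right hs hx, ← frameHerm_conj, hK.frameHerm_J_right hs hx, map_mul,
    frameHerm_conj, Complex.conj_I, ← mul_assoc]
  simp

/-- The pull-back of the Fubini-Study metric. -/
def metric : Bundle.ContMDiffRiemannianMetric 𝓘(ℝ, E) ∞ E
    (fun x : M => TangentSpace 𝓘(ℝ, E) x) where
  inner x := hermForm K ((2 : ℝ) • Complex.reCLM) x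
  symm x u v := by
    obtain ⟨U, s, hs, hx⟩ := hK.smooth x
    rw [hermForm_apply hs hx, hermForm_apply hs hx, ← frameHerm_conj s x u v]
    simp
  pos x u hu := by
    obtain ⟨U, s, hs, hx⟩ := hK.smooth x
    have h₁ : hderiv s x u ≠ 0 := fun h => hu (hK.hderiv_injective hs hx (by rw [h, map_zero]))
    have h₂ := norm_pos_iff.2 h₁
    have h₃ := norm_pos_iff.2 (hs.coe_ne_zero hx)
    have h₄ : hermForm K ((2 : ℝ) • Complex.reCLM) x u u = 2 * (frameHerm s x u u).re := by
      rw [hermForm_apply hs hx]; rfl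
    rw [h₄, frameHerm_self_re]
    positivity
  isVonNBounded x := by
    obtain ⟨U, s, hs, hx⟩ := hK.smooth x
    have h₃ := norm_pos_iff.2 (hs.coe_ne_zero hx)
    have h := isVonNBounded_of_injective (E := E) (hderiv s x : E →L[ℝ] H)
      (hK.hderiv_injective hs hx) (c := 2 / ‖(s x : H)‖ ^ 2) (by positivity)
    refine Bornology.IsVonNBounded.subset ?_ h
    intro u hu
    have h₄ : hermForm K ((2 : ℝ) • Complex.reCLM) x u u = 2 * (frameHerm s x u u).re := by
      rw [hermForm_apply hs hx]; rfl
    have h₅ : hermForm K ((2 : ℝ) • Complex.reCLM) x u u < 1 := hu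
    rw [h₄, frameHerm_self_re] at h₅
    change 2 / ‖(s x : H)‖ ^ 2 * ‖hderiv s x u‖ ^ 2 < 1
    calc _ = _ := by ring
      _ < 1 := h₅
  contMDiff x := contMDiffAt_bilin_of_coord
    (contMDiffAt_bilinInChart_hermForm hK.smooth ((2 : ℝ) • Complex.reCLM) x)
    (Eventually.of_forall fun y u v => bilinInChart_apply _ x y u v)

lemma metric_apply (hs : IsFrame (E := E) K U s) (hx : x ∈ U) (u v : TangentSpace 𝓘(ℝ, E) x) :
    hK.metric.inner x u v = 2 * (frameHerm s x u v).re := by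
  change hermForm K ((2 : ℝ) • Complex.reCLM) x u v = _
  rw [hermForm_apply hs hx]; rfl

omit [FiniteDimensional ℝ E] in
lemma hermForm_nondegenerate (x : M) (u : TangentSpace 𝓘(ℝ, E) x)
    (hu : ∀ v, hermForm K ((-2 : ℝ) • Complex.imCLM) x u v = 0) : u = 0 :=
  hK.nondegenerate x u fun v => by rw [hK.curvForm_eq_hermForm, hu, Complex.ofReal_zero]

lemma exists_hermForm_eq (x : M) (α : TangentSpace 𝓘(ℝ, E) x →L[ℝ] ℝ) :
    ∃ u, ∀ v, hermForm K ((-2 : ℝ) • Complex.imCLM) x u v = α v := by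
  let B : E →L[ℝ] E →L[ℝ] ℝ := hermForm K ((-2 : ℝ) • Complex.imCLM) x
  have hinj : Function.Injective B.toLinearMap := by
    rw [injective_iff_map_eq_zero]
    intro u hu
    exact hK.hermForm_nondegenerate x u fun v => DFunLike.congr_fun hu v
  have hfin : finrank ℝ E = finrank ℝ (E →L[ℝ] ℝ) := by
    rw [← (LinearMap.toContinuousLinearMap : (E →ₗ[ℝ] ℝ) ≃ₗ[ℝ] E →L[ℝ] ℝ).finrank_eq]
    exact (Subspace.dual_finrank_eq (K := ℝ) (V := E)).symm
  obtain ⟨u, hu⟩ := (LinearMap.injective_iff_surjective_of_finrank_eq_finrank hfin).1 hinj α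
  exact ⟨u, fun v => DFunLike.congr_fun hu v⟩

omit [FiniteDimensional ℝ E] in
-- Since ω is real, the Hamiltonian equation splits into one real equation for the real part and one
-- for the imaginary part.
lemma extC₂_eq_extC_iff {l : M → ℂ} {X : CTangent E x} :
    (∀ Z, extC₂ (curvForm K x) X Z = extC (vderiv l x) Z) ↔
      (∀ v, hermForm K ((-2 : ℝ) • Complex.imCLM) x (reT X) v = (vderiv l x v).re) ∧
      ∀ v, hermForm K ((-2 : ℝ) • Complex.imCLM) x (imT X) v = (vderiv l x v).im := by
  have h₀ (v : TangentSpace 𝓘(ℝ, E) x) : hermForm K ((-2 : ℝ) • Complex.imCLM) x v 0 = 0 := map_zero _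
  constructor
  · intro h
    have h' (v : TangentSpace 𝓘(ℝ, E) x) := h (mkT v 0)
    simp only [extC₂, hK.curvForm_eq_hermForm, extC_mkT, reT_mkT, imT_mkT, h₀, map_zero,
      smul_zero, add_zero] at h'
    exact ⟨fun v => by simpa using congrArg Complex.re (h' v),
      fun v => by simpa using congrArg Complex.im (h' v)⟩
  · rintro ⟨h₁, h₂⟩ Z
    simp only [extC₂, hK.curvForm_eq_hermForm, extC, h₁, h₂]
    apply Complex.ext
    · simp [sub_eq_add_neg]
    · simp [add_comm]

/-- Smooth functions have Hamiltonian vector fields. -/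
lemma existsUnique_isHamiltonian {l : M → ℂ} (hl : ContMDiff 𝓘(ℝ, E) 𝓘(ℝ, ℂ) ∞ l) :
    ∃! X, IsHamiltonian (curvForm (E := E) K) l X := by
  choose X hX using fun x => hK.exists_hermForm_eq x
    (Complex.reCLM.comp (vderiv l x) : TangentSpace 𝓘(ℝ, E) x →L[ℝ] ℝ)
  choose Y hY using fun x => hK.exists_hermForm_eq x
    (Complex.imCLM.comp (vderiv l x) : TangentSpace 𝓘(ℝ, E) x →L[ℝ] ℝ)
  have hsm (φ : ℂ →L[ℝ] ℝ) (x₀ : M) : ContMDiffAt 𝓘(ℝ, E) 𝓘(ℝ, E →L[ℝ] ℝ) ∞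
      (fun x => ((φ.comp (vderiv l x)).comp (coordFrame x₀ x) : E →L[ℝ] ℝ)) x₀ :=
    (ContinuousLinearMap.compL ℝ E ℂ ℝ φ).contDiff.contDiffAt.contMDiffAt.comp x₀
      (hl x₀).vderiv_comp_coordFrame
  refine ⟨fun x => mkT (X x) (Y x), ⟨⟨fun x => ?_, fun x => ?_⟩, fun x => ?_⟩, fun Z hZ => ?_⟩
  · simp only [reT_mkT]
    exact contMDiffAt_field_of_nondegenerate (contMDiffAt_bilinInChart_hermForm hK.smooth _ x)
      hK.hermForm_nondegenerate (hsm Complex.reCLM x) hX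
  · simp only [imT_mkT]
    exact contMDiffAt_field_of_nondegenerate (contMDiffAt_bilinInChart_hermForm hK.smooth _ x)
      hK.hermForm_nondegenerate (hsm Complex.imCLM x) hY
  · rw [hK.extC₂_eq_extC_iff]
    exact ⟨fun v => by rw [reT_mkT]; exact hX x v, fun v => by rw [imT_mkT]; exact hY x v⟩
  · funext x
    obtain ⟨h₁, h₂⟩ := hK.extC₂_eq_extC_iff.1 (hZ.2 x)
    refine extT ?_ ?_
    · rw [reT_mkT, ← sub_eq_zero]
      refine hK.hermForm_nondegenerate x _ fun v => ?_
      rw [map_sub, sub_apply, h₁, hX]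
      exact sub_self _
    · rw [imT_mkT, ← sub_eq_zero]
      refine hK.hermForm_nondegenerate x _ fun v => ?_
      rw [map_sub, sub_apply, h₂, hY]
      exact sub_self _

/-- The Hamiltonian vector fields of multipliers span the distribution. -/
lemma distribution_eq_span_hamiltonian (x : M) : distribution (E := E) K x = Submodule.span ℂ
    {Z | ∃ l ∈ multipliers (E := E) K, ∃ X, IsHamiltonian (curvForm K) l X ∧ X x = Z} := by
  symm
  have : FiniteDimensional ℝ (TangentSpace 𝓘(ℝ, E) x) := inferInstanceAs (FiniteDimensional ℝ E)
  refine Submodule.eq_of_le_of_finrank_le ?_ ?_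
  · refine Submodule.span_le.2 ?_
    rintro _ ⟨l, hl, X, hX, rfl⟩
    -- ω(X_λ, W) = dλ(W) = 0 for W in P, and P contains its own ω-orthogonal.
    refine hK.mem_distribution_of_orthogonal fun W hW => ?_
    rw [hX.2, hK.extC_multiplier_eq_zero hl hW]
  · rw [hK.maximal x]
    obtain ⟨U, hU, hx, l, hl, hli⟩ := hK.coordinates x
    choose X hX hX' using fun i => hK.existsUnique_isHamiltonian (hl i).1
    -- Contraction with ω sends a relation between the fields to the same relation between the
    -- differentials.
    have hX'' : LinearIndependent ℂ (fun i => X i x) := by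
      have h := hli x hx
      rw [Fintype.linearIndependent_iff] at h ⊢
      intro c hc
      refine h c ?_
      ext v
      have h₁ (i : Fin N) := hK.extC₂_eq_extC_iff.1 ((hX i).2 x)
      have h₂ := congrArg (fun Z => hermForm K ((-2 : ℝ) • Complex.imCLM) x (reT Z) v) hc
      have h₃ := congrArg (fun Z => hermForm K ((-2 : ℝ) • Complex.imCLM) x (imT Z) v) hc
      simp only [map_sum, reT_smul, imT_smul, map_sub, map_add, map_smul, sum_apply, sub_apply,
        add_apply, smul_apply, (h₁ _).1, (h₁ _).2, map_zero, zero_apply, smul_eq_mul] at h₂ h₃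
      simp only [sum_apply, smul_apply, zero_apply, smul_eq_mul]
      apply Complex.ext
      · simpa using h₂
      · simpa using h₃
    have h₂ : Set.range (fun i => X i x) ⊆ {Z | ∃ l ∈ multipliers (E := E) K, ∃ X,
        IsHamiltonian (curvForm K) l X ∧ X x = Z} := by
      rintro _ ⟨i, rfl⟩
      exact ⟨l i, hl i, X i, hX i, rfl⟩
    have h₃ := finrank_span_eq_card hX''
    rw [Fintype.card_fin] at h₃
    rw [← h₃]
    exact Submodule.finrank_mono (Submodule.span_mono h₂)

end IsCoherentStateMap

end Metric

/-! ### From complex linear derivatives to holomorphy -/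

section Holomorphic

variable {V W : Type*} [NormedAddCommGroup V] [NormedSpace ℂ V] [NormedAddCommGroup W]
  [NormedSpace ℂ W]

/-- A real linear map commuting with `i` is complex linear. -/
def complexify (L : V →L[ℝ] W) (h : ∀ v, L (Complex.I • v) = Complex.I • L v) : V →L[ℂ] W where
  toFun := L
  map_add' := map_add L
  map_smul' c v := by
    rw [RingHom.id_apply, ← Complex.re_add_im c, add_smul, add_smul, map_add, mul_smul, mul_smul,
      Complex.coe_smul, Complex.coe_smul, Complex.coe_smul, Complex.coe_smul, map_smul, map_smul, h]
  cont := L.continuous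

lemma differentiableAt_complex {f : V → W} {z : V} (hf : DifferentiableAt ℝ f z)
    (h : ∀ v, fderiv ℝ f z (Complex.I • v) = Complex.I • fderiv ℝ f z v) :
    DifferentiableAt ℂ f z :=
  (differentiableAt_iff_restrictScalars ℝ hf).2 ⟨complexify _ h, rfl⟩

/-- Real smoothness is given, so induction on the order suffices: the derivative of `f` in a fixed
direction is again smooth with complex linear derivative. -/
lemma contDiffOn_complex_nat [FiniteDimensional ℂ V] {U : Set V} (hU : IsOpen U) (n : ℕ)
    {f : V → W} (hf : ContDiffOn ℝ ∞ f U)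
    (h : ∀ z ∈ U, ∀ v, fderiv ℝ f z (Complex.I • v) = Complex.I • fderiv ℝ f z v) :
    ContDiffOn ℂ n f U := by
  induction n generalizing f with
  | zero => exact contDiffOn_zero.2 hf.continuousOn
  | succ n ih =>
    have hfz (z : V) (hz : z ∈ U) : ContDiffAt ℝ ∞ f z := hf.contDiffAt (hU.mem_nhds hz)
    have hd (z : V) (hz : z ∈ U) : DifferentiableAt ℂ f z :=
      differentiableAt_complex ((hfz z hz).differentiableAt (by simp)) (h z hz)
    push_cast
    refine contDiffOn_succ_of_fderiv_apply (fun z hz => (hd z hz).differentiableWithinAt)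
      (fun hn => by simp at hn) fun v => ?_
    have hf' : ContDiffOn ℝ ∞ (fderiv ℝ f) U := hf.fderiv_of_isOpen hU (m := ∞) le_rfl
    have hv : ContDiffOn ℝ ∞ (fun z => fderiv ℝ f z v) U := hf'.clm_apply contDiffOn_const
    have key : ContDiffOn ℂ n (fun z => fderiv ℝ f z v) U := by
      refine ih hv fun z hz w => ?_
      have hdd : DifferentiableAt ℝ (fderiv ℝ f) z :=
        (hf'.contDiffAt (hU.mem_nhds hz)).differentiableAt (by simp)
      have hap (v w : V) : fderiv ℝ (fun z => fderiv ℝ f z v) z w = fderiv ℝ (fderiv ℝ f) z w v := by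
        rw [fderiv_clm_apply hdd (by fun_prop)]
        simp
      have hsymm (v w : V) : fderiv ℝ (fderiv ℝ f) z v w = fderiv ℝ (fderiv ℝ f) z w v :=
        ((hfz z hz).isSymmSndFDerivAt two_le_smooth).eq v w
      have heq : (fun z => fderiv ℝ f z (Complex.I • w)) =ᶠ[𝓝 z]
          fun z => Complex.I • fderiv ℝ f z w := by
        filter_upwards [hU.mem_nhds hz] with y hy using h y hy w
      -- With B the symmetric second derivative, B(iw, v) = B(v, iw) is the derivative along v of
      -- f'(iw) = i f'(w), hence equals i B(v, w) = i B(w, v).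
      rw [hap, hap, hsymm, ← hap, heq.fderiv_eq, hsymm w v, ← hap w v]
      have hw : DifferentiableAt ℝ (fun z => fderiv ℝ f z w) z :=
        hdd.clm_apply (differentiableAt_const w)
      rw [fderiv_fun_const_smul hw]
      rfl
    refine key.congr fun z hz => ?_
    rw [fderivWithin_of_isOpen hU hz, (hd z hz).fderiv_restrictScalars ℝ]
    rfl

lemma contDiffOn_complex [FiniteDimensional ℂ V] {U : Set V} (hU : IsOpen U)
    {f : V → W} (hf : ContDiffOn ℝ ∞ f U)
    (h : ∀ z ∈ U, ∀ v, fderiv ℝ f z (Complex.I • v) = Complex.I • fderiv ℝ f z v) :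
    ContDiffOn ℂ ∞ f U :=
  contDiffOn_infty.2 fun n => contDiffOn_complex_nat hU n hf h

end Holomorphic

/-! ### Complex charts and the inverse function theorem -/

section Charts

open Filter

variable {E : Type*} [NormedAddCommGroup E] [NormedSpace ℝ E]
  {M : Type*} [TopologicalSpace M] [ChartedSpace E M] [IsManifold 𝓘(ℝ, E) ∞ M]
  {V W : Type*} [NormedAddCommGroup V] [NormedSpace ℂ V] [NormedAddCommGroup W] [NormedSpace ℂ W]

/-- A diffeomorphism from an open set of `M` to a complex vector space that is compatible with the
almost complex structure `J`. -/
structure IsHolChart (J : (x : M) → TangentSpace 𝓘(ℝ, E) x →L[ℝ] TangentSpace 𝓘(ℝ, E) x)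
    (e : OpenPartialHomeomorph M V) : Prop where
  smooth : ContMDiffOn 𝓘(ℝ, E) 𝓘(ℝ, V) ∞ e e.source
  smooth_symm : ContMDiffOn 𝓘(ℝ, V) 𝓘(ℝ, E) ∞ e.symm e.target
  deriv_J : ∀ x ∈ e.source, ∀ u, vderiv e x (J x u) = Complex.I • vderiv (E := E) e x u

variable {J : (x : M) → TangentSpace 𝓘(ℝ, E) x →L[ℝ] TangentSpace 𝓘(ℝ, E) x}
  {e : OpenPartialHomeomorph M V}

omit [IsManifold 𝓘(ℝ, E) ∞ M] in
/-- Maps with complex linear differential are holomorphic in complex charts. -/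
lemma IsHolChart.fderiv_I_smul (he : IsHolChart J e) {z : V} (hz : z ∈ e.target) {f : M → W}
    (hf : MDifferentiableAt 𝓘(ℝ, E) 𝓘(ℝ, W) f (e.symm z))
    (hJ : ∀ u, vderiv f (e.symm z) (J _ u) = Complex.I • vderiv (E := E) f (e.symm z) u) :
    DifferentiableAt ℝ (f ∘ e.symm) z ∧
      ∀ w, fderiv ℝ (f ∘ e.symm) z (Complex.I • w) = Complex.I • fderiv ℝ (f ∘ e.symm) z w := by
  set y := e.symm z with hy
  have hys : y ∈ e.source := e.map_target hz
  have h₁ : MDifferentiableAt 𝓘(ℝ, V) 𝓘(ℝ, E) e.symm z :=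
    ((he.smooth_symm.contMDiffAt (e.open_target.mem_nhds hz))).mdifferentiableAt (by simp)
  have h₂ : MDifferentiableAt 𝓘(ℝ, E) 𝓘(ℝ, V) e y :=
    (he.smooth.contMDiffAt (e.open_source.mem_nhds hys)).mdifferentiableAt (by simp)
  let T : V →L[ℝ] TangentSpace 𝓘(ℝ, E) y := mfderiv 𝓘(ℝ, V) 𝓘(ℝ, E) e.symm z
  have hfT (w : V) : fderiv ℝ (f ∘ e.symm) z w = vderiv f y (T w) := by
    rw [← mfderiv_eq_fderiv]
    exact mfderiv_comp_apply z hf h₁ w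
  have heT (w : V) : vderiv e y (T w) = w := by
    have h : mfderiv 𝓘(ℝ, V) 𝓘(ℝ, V) (e ∘ e.symm) z w = vderiv e y (T w) :=
      mfderiv_comp_apply z h₂ h₁ w
    have h' : (e ∘ e.symm) =ᶠ[𝓝 z] id := by
      filter_upwards [e.open_target.mem_nhds hz] with t ht using e.right_inv ht
    rw [h'.mfderiv_eq, mfderiv_id] at h
    exact h.symm
  have hTe (u : TangentSpace 𝓘(ℝ, E) y) : T (vderiv e y u) = u := by
    have hez : e y = z := e.right_inv hz
    have h : mfderiv 𝓘(ℝ, E) 𝓘(ℝ, E) (e.symm ∘ e) y u = T (vderiv e y u) :=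
      mfderiv_comp_apply_of_eq (x := y) h₁ h₂ hez u
    have h' : (e.symm ∘ e) =ᶠ[𝓝 y] id := by
      filter_upwards [e.open_source.mem_nhds hys] with t ht using e.left_inv ht
    rw [h'.mfderiv_eq, mfderiv_id] at h
    exact h.symm
  refine ⟨mdifferentiableAt_iff_differentiableAt.1 (hf.comp z h₁), fun w => ?_⟩
  -- `T` inverts the derivative of `e`, which carries `J` to i; so `T` carries i back to `J`.
  have hTI : T (Complex.I • w) = J y (T w) := by
    rw [← hTe (J y (T w)), he.deriv_J y hys, heT]
  rw [hfT, hfT, hTI, hJ]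

omit [IsManifold 𝓘(ℝ, E) ∞ M] in
lemma IsHolChart.contDiffOn_transition [FiniteDimensional ℂ V] (he : IsHolChart J e)
    {e' : OpenPartialHomeomorph M V} (he' : IsHolChart J e') :
    ContDiffOn ℂ ∞ (e.symm ≫ₕ e') (e.symm ≫ₕ e').source := by
  have hs : ∀ z ∈ (e.symm ≫ₕ e').source, z ∈ e.target ∧ e.symm z ∈ e'.source := fun z hz => by
    simpa using hz
  refine contDiffOn_complex (e.symm ≫ₕ e').open_source ?_ fun z hz => ?_
  · rw [← contMDiffOn_iff_contDiffOn]
    exact he'.smooth.comp (he.smooth_symm.mono fun z hz => (hs z hz).1) fun z hz => (hs z hz).2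
  · refine (he.fderiv_I_smul (hs z hz).1 (f := e') ?_ ?_).2
    · exact (he'.smooth.contMDiffAt (e'.open_source.mem_nhds (hs z hz).2)).mdifferentiableAt (by simp)
    · exact he'.deriv_J _ (hs z hz).2

/-- The inverse function theorem on a manifold. -/
lemma exists_openPartialHomeomorph [FiniteDimensional ℝ E] [FiniteDimensional ℂ V] {f : M → V}
    (hf : ContMDiff 𝓘(ℝ, E) 𝓘(ℝ, V) ∞ f) {U : Set M} (hU : IsOpen U)
    (hinj : ∀ x ∈ U, ∀ u : TangentSpace 𝓘(ℝ, E) x, vderiv f x u = 0 → u = 0)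
    (hfin : finrank ℝ E = finrank ℝ V) {x : M} (hx : x ∈ U) :
    ∃ e : OpenPartialHomeomorph M V, x ∈ e.source ∧ e.source ⊆ U ∧ EqOn e f e.source ∧
      ContMDiffOn 𝓘(ℝ, V) 𝓘(ℝ, E) ∞ e.symm e.target := by
  have : FiniteDimensional ℝ V := FiniteDimensional.complexToReal V
  set c := chartAt E x
  have hcx := mem_chart_source E x
  set F : E → V := f ∘ c.symm with hF
  have hFd (y : M) (hy : y ∈ c.source) : ContDiffAt ℝ ∞ F (c y) := contDiffAt_comp_chart_symm hy (hf y)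
  have hder (y : M) (hy : y ∈ c.source) (hyU : y ∈ U) :
      ∃ L : E ≃L[ℝ] V, HasFDerivAt F (L : E →L[ℝ] V) (c y) := by
    have h₁ := vderiv_comp_coordFrame hy ((hf y).mdifferentiableAt (by simp))
    have h₂ : Function.Injective (fderiv ℝ F (c y)).toLinearMap := by
      rw [injective_iff_map_eq_zero]
      intro u hu
      have h₃ : vderiv f y (coordFrame x y u) = 0 := (DFunLike.congr_fun h₁ u).trans hu
      rw [← coordMap_coordFrame hy u, hinj y hyU _ h₃, map_zero]
    let L := (LinearEquiv.ofInjectiveOfFinrankEq _ h₂ hfin).toContinuousLinearEquiv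
    refine ⟨L, ?_⟩
    have hL : (L : E →L[ℝ] V) = fderiv ℝ F (c y) := by ext; rfl
    rw [hL]
    exact ((hFd y hy).differentiableAt (by simp)).hasFDerivAt
  obtain ⟨L, hL⟩ := hder x hcx hx
  let h := (hFd x hcx).toOpenPartialHomeomorph F hL (by simp)
  have hxh : c x ∈ h.source := (hFd x hcx).mem_toOpenPartialHomeomorph_source hL (by simp)
  have hhF (t : E) : h t = F t := rfl
  let e := (c ≫ₕ h).restrOpen U hU
  have hes : ∀ y, y ∈ e.source ↔ (y ∈ c.source ∧ c y ∈ h.source) ∧ y ∈ U := fun y => by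
    simp [e]
  have hef : EqOn e f e.source := fun y hy => by
    have : e y = f (c.symm (c y)) := rfl
    rw [this, c.left_inv ((hes y).1 hy).1.1]
  refine ⟨e, (hes x).2 ⟨⟨hcx, hxh⟩, hx⟩, fun y hy => ((hes y).1 hy).2, hef, fun z hz => ?_⟩
  have hy := e.map_target hz
  set y := e.symm z with hyz
  have hy' := (hes y).1 hy
  have hz' : h.symm z = c y := by
    have h₁ : e y = z := e.right_inv hz
    have h₂ : h (c y) = z := h₁
    rw [← h₂, h.left_inv hy'.1.2]
  have hzt : z ∈ h.target := by
    have h₁ : h (c y) = z := e.right_inv hz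
    rw [← h₁]
    exact h.map_source hy'.1.2
  -- Smoothness of the inverse is needed on the whole target, not only at the image of x. The
  -- derivative is invertible throughout `U`, so it can be checked at each point.
  obtain ⟨L', hL'⟩ := hder y hy'.1.1 hy'.2
  have h₃ : ContDiffAt ℝ ∞ h.symm z := by
    refine h.contDiffAt_symm hzt (f₀' := L') ?_ ?_
    · rw [hz']; exact hL'
    · rw [hz']; exact hFd y hy'.1.1
  have h₄ : ContMDiffAt 𝓘(ℝ, E) 𝓘(ℝ, E) ∞ c.symm (h.symm z) := by
    rw [hz']
    exact (contMDiffOn_chart_symm (I := 𝓘(ℝ, E)) (x := x) (n := ∞)).contMDiffAt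
      (c.open_target.mem_nhds (c.map_source hy'.1.1))
  exact (h₄.comp z h₃.contMDiffAt).contMDiffWithinAt

end Charts

/-! ### The Lie bracket in a chart and the commutator formula -/

section Bracket

open Filter VectorField

variable {E : Type*} [NormedAddCommGroup E] [NormedSpace ℝ E]
  {M : Type*} [TopologicalSpace M] [ChartedSpace E M] [IsManifold 𝓘(ℝ, E) ∞ M]
  {F : Type*} [NormedAddCommGroup F] [NormedSpace ℝ F]

/-- The components of a vector field in the preferred chart at `x₀`. -/
def fieldInChart (X : (x : M) → TangentSpace 𝓘(ℝ, E) x) (x₀ : M) (z : E) : E :=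
  coordMap x₀ ((chartAt E x₀).symm z) (X ((chartAt E x₀).symm z))

lemma mpullbackWithin_extChartAt_symm_eventuallyEq (X : (x : M) → TangentSpace 𝓘(ℝ, E) x) (x₀ : M) :
    mpullbackWithin 𝓘(ℝ, E) 𝓘(ℝ, E) (extChartAt 𝓘(ℝ, E) x₀).symm X (range 𝓘(ℝ, E))
      =ᶠ[𝓝 (chartAt E x₀ x₀)] fieldInChart X x₀ := by
  filter_upwards [(chartAt E x₀).open_target.mem_nhds (mem_chart_target E x₀)] with z hz
  have hy := (chartAt E x₀).map_target hz
  have hzy : extChartAt 𝓘(ℝ, E) x₀ ((chartAt E x₀).symm z) = z := (chartAt E x₀).right_inv hz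
  have h : (mfderivWithin 𝓘(ℝ, E) 𝓘(ℝ, E) (extChartAt 𝓘(ℝ, E) x₀).symm (range 𝓘(ℝ, E)) z).inverse =
      coordMap (E := E) x₀ ((chartAt E x₀).symm z) := by
    have h' : (coordFrame (E := E) x₀ ((chartAt E x₀).symm z)).inverse =
        coordMap (E := E) x₀ ((chartAt E x₀).symm z) := by
      refine ContinuousLinearMap.inverse_eq ?_ ?_
      · ext u; exact coordFrame_coordMap hy u
      · ext u; exact coordMap_coordFrame hy u
    rw [coordFrame, hzy] at h'
    exact h'
  exact DFunLike.congr_fun h _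

lemma mlieBracket_eq_fderiv (X Y : (x : M) → TangentSpace 𝓘(ℝ, E) x) (x : M) :
    mlieBracket 𝓘(ℝ, E) X Y x =
      (fderiv ℝ (fieldInChart Y x) (chartAt E x x) (X x) -
        fderiv ℝ (fieldInChart X x) (chartAt E x x) (Y x) : E) := by
  let V : E → E :=
    mpullbackWithin 𝓘(ℝ, E) 𝓘(ℝ, E) (extChartAt 𝓘(ℝ, E) x).symm X (range 𝓘(ℝ, E))
  let W : E → E :=
    mpullbackWithin 𝓘(ℝ, E) 𝓘(ℝ, E) (extChartAt 𝓘(ℝ, E) x).symm Y (range 𝓘(ℝ, E))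
  have hV : V =ᶠ[𝓝 (chartAt E x x)] fieldInChart X x :=
    mpullbackWithin_extChartAt_symm_eventuallyEq X x
  have hW : W =ᶠ[𝓝 (chartAt E x x)] fieldInChart Y x :=
    mpullbackWithin_extChartAt_symm_eventuallyEq Y x
  have hself (X : (x : M) → TangentSpace 𝓘(ℝ, E) x) : fieldInChart X x (chartAt E x x) = X x := by
    rw [fieldInChart, (chartAt E x).left_inv (mem_chart_source E x)]
    exact coordMap_self x (X x)
  have h : lieBracketWithin ℝ V W
      ((extChartAt 𝓘(ℝ, E) x).symm ⁻¹' univ ∩ range 𝓘(ℝ, E)) (chartAt E x x) =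
      fderiv ℝ (fieldInChart Y x) (chartAt E x x) (X x) -
        fderiv ℝ (fieldInChart X x) (chartAt E x x) (Y x) := by
    have hu : (extChartAt 𝓘(ℝ, E) x).symm ⁻¹' univ ∩ range 𝓘(ℝ, E) = univ := by simp
    rw [hu, lieBracketWithin_univ]
    change fderiv ℝ W _ (V _) - fderiv ℝ V _ (W _) = _
    rw [hV.fderiv_eq, hW.fderiv_eq, hV.eq_of_nhds, hW.eq_of_nhds, hself, hself]
  rw [← mlieBracketWithin_univ, mlieBracketWithin_apply, mfderiv_extChartAt_self]
  have h' : ContinuousLinearMap.inverse (ContinuousLinearMap.id ℝ E) = ContinuousLinearMap.id ℝ E :=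
    ContinuousLinearMap.inverse_id
  exact (DFunLike.congr_fun h' _).trans h

/-- The commutator formula for the derivatives along two vector fields. -/
lemma vderiv_mlieBracket {X Y : (x : M) → TangentSpace 𝓘(ℝ, E) x} {x : M}
    (hX : ContMDiffAt 𝓘(ℝ, E) 𝓘(ℝ, E).tangent ∞
      (fun x => (⟨x, X x⟩ : TangentBundle 𝓘(ℝ, E) M)) x)
    (hY : ContMDiffAt 𝓘(ℝ, E) 𝓘(ℝ, E).tangent ∞
      (fun x => (⟨x, Y x⟩ : TangentBundle 𝓘(ℝ, E) M)) x)
    {f : M → F} (hf : ContMDiff 𝓘(ℝ, E) 𝓘(ℝ, F) ∞ f) :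
    vderiv f x (mlieBracket 𝓘(ℝ, E) X Y x) =
      vderiv (fun y => vderiv f y (Y y)) x (X x) - vderiv (fun y => vderiv f y (X y)) x (Y x) := by
  set c := chartAt E x
  set G : E → F := f ∘ c.symm with hG
  have hGd : ContDiffAt ℝ ∞ G (c x) := contDiffAt_comp_chart_symm (mem_chart_source E x) (hf x)
  have hG' : ContDiffAt ℝ ∞ (fderiv ℝ G) (c x) := hGd.fderiv_right (m := ∞) le_rfl
  have hfd (y : M) : MDifferentiableAt 𝓘(ℝ, E) 𝓘(ℝ, F) f y := (hf y).mdifferentiableAt (by simp)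
  -- The product rule for df(Z) yields a second derivative of f plus df applied to the derivative of
  -- Z. In the commutator the second derivatives cancel by symmetry, and the rest is df of the
  -- bracket.
  have key {Z : (x : M) → TangentSpace 𝓘(ℝ, E) x} (hZ : ContMDiffAt 𝓘(ℝ, E) 𝓘(ℝ, E).tangent ∞
      (fun x => (⟨x, Z x⟩ : TangentBundle 𝓘(ℝ, E) M)) x) (u : TangentSpace 𝓘(ℝ, E) x) :
      vderiv (fun y => vderiv f y (Z y)) x u = fderiv ℝ (fderiv ℝ G) (c x) u (Z x) +
        fderiv ℝ G (c x) (fderiv ℝ (fieldInChart Z x) (c x) u) := by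
    have ha := contMDiffAt_coordMap_field hZ
    have hZd : ContDiffAt ℝ ∞ (fieldInChart Z x) (c x) :=
      contDiffAt_comp_chart_symm (mem_chart_source E x) ha
    have heq : (fun y => vderiv f y (Z y)) =ᶠ[𝓝 x]
        fun y => fderiv ℝ G (c y) (coordMap (E := E) x y (Z y)) := by
      filter_upwards [c.open_source.mem_nhds (mem_chart_source E x)] with y hy
      exact vderiv_apply_eq hy (hfd y) _
    have hsm : ContMDiffAt 𝓘(ℝ, E) 𝓘(ℝ, F) ∞ (fun y => fderiv ℝ G (c y) (coordMap (E := E) x y (Z y))) x :=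
      (hG'.contMDiffAt.comp x (contMDiffAt_chart_self x (mem_chart_source E x))).clm_apply ha
    have h₁ : vderiv (fun y => vderiv f y (Z y)) x =
        vderiv (E := E) (fun y => fderiv ℝ G (c y) (coordMap (E := E) x y (Z y))) x := heq.mfderiv_eq
    rw [h₁, vderiv_eq_fderiv (hsm.mdifferentiableAt (by simp))]
    have heq' : (fun y => fderiv ℝ G (c y) (coordMap (E := E) x y (Z y))) ∘ c.symm =ᶠ[𝓝 (c x)]
        fun z => fderiv ℝ G z (fieldInChart Z x z) := by
      filter_upwards [c.open_target.mem_nhds (mem_chart_target E x)] with z hz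
      simp only [Function.comp, fieldInChart, c.right_inv hz]
      rfl
    rw [heq'.fderiv_eq, fderiv_clm_apply (hG'.differentiableAt (by simp))
      (hZd.differentiableAt (by simp))]
    have hself : fieldInChart Z x (c x) = Z x := by
      rw [fieldInChart, c.left_inv (mem_chart_source E x)]
      exact coordMap_self x (Z x)
    rw [hself]
    exact add_comm _ _
  rw [key hX, key hY, vderiv_eq_fderiv (hfd x), mlieBracket_eq_fderiv]
  have hsymm := (hGd.isSymmSndFDerivAt two_le_smooth).eq (X x) (Y x)
  have hsub := map_sub (fderiv ℝ G (c x)) (fderiv ℝ (fieldInChart Y x) (c x) (X x))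
    (fderiv ℝ (fieldInChart X x) (c x) (Y x))
  refine hsub.trans ?_
  rw [hsymm]
  abel

end Bracket

/-! ### Smooth complex vector fields and their brackets -/

section SmoothFields

open Filter VectorField

variable {E : Type*} [NormedAddCommGroup E] [NormedSpace ℝ E]
  {M : Type*} [TopologicalSpace M] [ChartedSpace E M] [IsManifold 𝓘(ℝ, E) ∞ M]
  {X Y : (x : M) → TangentSpace 𝓘(ℝ, E) x}

lemma contMDiff_field_combination (r t : ℝ)
    (hX : ContMDiff 𝓘(ℝ, E) 𝓘(ℝ, E).tangent ∞ (fun x => (⟨x, X x⟩ : TangentBundle 𝓘(ℝ, E) M)))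
    (hY : ContMDiff 𝓘(ℝ, E) 𝓘(ℝ, E).tangent ∞ (fun x => (⟨x, Y x⟩ : TangentBundle 𝓘(ℝ, E) M))) :
    ContMDiff 𝓘(ℝ, E) 𝓘(ℝ, E).tangent ∞
      (fun x => (⟨x, r • X x + t • Y x⟩ : TangentBundle 𝓘(ℝ, E) M)) := fun x => by
  have h (r : ℝ) {X : (x : M) → TangentSpace 𝓘(ℝ, E) x} (hX : ContMDiff 𝓘(ℝ, E) 𝓘(ℝ, E).tangent ∞
      (fun x => (⟨x, X x⟩ : TangentBundle 𝓘(ℝ, E) M))) :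
      ContMDiffAt 𝓘(ℝ, E) 𝓘(ℝ, E) ∞ (fun y => r • coordMap x y (X y)) x :=
    (contDiff_const_smul r).contMDiff.contMDiffAt.comp x (contMDiffAt_coordMap_field (hX x))
  refine contMDiffAt_field_of_coord ((h r hX).add (h t hY)) (Eventually.of_forall fun y => ?_)
  rw [map_add, map_smul, map_smul]
  rfl

lemma contMDiff_mlieBracket [CompleteSpace E]
    (hX : ContMDiff 𝓘(ℝ, E) 𝓘(ℝ, E).tangent ∞ (fun x => (⟨x, X x⟩ : TangentBundle 𝓘(ℝ, E) M)))
    (hY : ContMDiff 𝓘(ℝ, E) 𝓘(ℝ, E).tangent ∞ (fun x => (⟨x, Y x⟩ : TangentBundle 𝓘(ℝ, E) M))) :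
    ContMDiff 𝓘(ℝ, E) 𝓘(ℝ, E).tangent ∞
      (fun x => (⟨x, mlieBracket 𝓘(ℝ, E) X Y x⟩ : TangentBundle 𝓘(ℝ, E) M)) := by
  have : IsManifold 𝓘(ℝ, E) (((⊤ : ℕ∞) : WithTop ℕ∞) + 1) M := ‹IsManifold 𝓘(ℝ, E) ∞ M›
  have : IsManifold 𝓘(ℝ, E) (minSmoothness ℝ 2) M :=
    IsManifold.of_le (n := ∞) two_le_smooth
  exact ContDiff.mlieBracket_vectorField (m := ⊤) (n := ⊤) hX hY (by simp)

/-- Complex linear combinations of smooth complex fields are smooth. -/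
lemma SmoothField.add_smul {X Y : (x : M) → CTangent E x} (hX : SmoothField X) (hY : SmoothField Y)
    (a : ℂ) : SmoothField (fun x => X x + a • Y x) := by
  constructor
  · refine (contMDiff_field_combination 1 1 hX.1
      (contMDiff_field_combination a.re (-a.im) hY.1 hY.2)).congr fun x => ?_
    simp only [map_add, reT_smul, one_smul, neg_smul, sub_eq_add_neg]
  · refine (contMDiff_field_combination 1 1 hX.2
      (contMDiff_field_combination a.re a.im hY.2 hY.1)).congr fun x => ?_
    simp only [map_add, imT_smul, one_smul]

lemma SmoothField.zero : SmoothField (fun x : M => (0 : CTangent E x)) := by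
  have h : ContMDiff 𝓘(ℝ, E) 𝓘(ℝ, E).tangent ∞
      (fun x => (⟨x, 0⟩ : TangentBundle 𝓘(ℝ, E) M)) := fun x =>
    contMDiffAt_field_of_coord contMDiffAt_const (Eventually.of_forall fun y => map_zero _)
  constructor <;> simpa using h

lemma SmoothField.bracket [CompleteSpace E] {X Y : (x : M) → CTangent E x} (hX : SmoothField X)
    (hY : SmoothField Y) : SmoothField (bracket X Y) := by
  constructor
  · refine (contMDiff_field_combination 1 (-1) (contMDiff_mlieBracket hX.1 hY.1)
      (contMDiff_mlieBracket hX.2 hY.2)).congr fun x => ?_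
    simp [CoherentState.bracket, sub_eq_add_neg]
  · refine (contMDiff_field_combination 1 1 (contMDiff_mlieBracket hX.1 hY.2)
      (contMDiff_mlieBracket hX.2 hY.1)).congr fun x => ?_
    simp [CoherentState.bracket]

/-- The commutator formula for functions annihilated by two complex vector fields. -/
lemma extC_vderiv_bracket_eq_zero {X Y : (x : M) → CTangent E x} (hX : SmoothField X)
    (hY : SmoothField Y) {f : M → ℂ} (hf : ContMDiff 𝓘(ℝ, E) 𝓘(ℝ, ℂ) ∞ f)
    (hfX : ∀ x, extC (vderiv f x) (X x) = 0) (hfY : ∀ x, extC (vderiv f x) (Y x) = 0) (x : M) :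
    extC (vderiv f x) (CoherentState.bracket X Y x) = 0 := by
  have hsm {Z : (x : M) → TangentSpace 𝓘(ℝ, E) x} (hZ : ContMDiff 𝓘(ℝ, E) 𝓘(ℝ, E).tangent ∞
      (fun x => (⟨x, Z x⟩ : TangentBundle 𝓘(ℝ, E) M))) :
      MDifferentiableAt 𝓘(ℝ, E) 𝓘(ℝ, ℂ) (fun y => vderiv f y (Z y)) x := by
    have h : ContMDiffAt 𝓘(ℝ, E) 𝓘(ℝ, ℂ) ∞
        (fun y => (vderiv f y).comp (coordFrame x y) (coordMap x y (Z y))) x :=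
      ((hf x).vderiv_comp_coordFrame).clm_apply (contMDiffAt_coordMap_field (hZ x))
    refine (h.congr_of_eventuallyEq ?_).mdifferentiableAt (by simp)
    filter_upwards [(chartAt E x).open_source.mem_nhds (mem_chart_source E x)] with y hy
    exact congrArg (vderiv f y) (coordFrame_coordMap hy _).symm
  -- Zf = 0 reads df(Re Z) = -i df(Im Z) at every point, so the relation may be differentiated.
  have key {Z : (x : M) → CTangent E x} (hZ : SmoothField Z)
      (hfZ : ∀ x, extC (vderiv f x) (Z x) = 0) (u : TangentSpace 𝓘(ℝ, E) x) :
      vderiv (fun y => vderiv f y (reT (Z y))) x u =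
        -(Complex.I * vderiv (fun y => vderiv f y (imT (Z y))) x u) := by
    have h : (fun y => vderiv f y (reT (Z y))) =
        fun y => (-Complex.I • ContinuousLinearMap.id ℝ ℂ) (vderiv f y (imT (Z y))) := by
      ext1 y
      have := hfZ y
      rw [extC, smul_eq_mul] at this
      simpa using eq_neg_of_add_eq_zero_left this
    rw [h, vderiv_clm_comp _ (hsm hZ.2)]
    simp
  rw [CoherentState.bracket, extC_mkT, map_sub, map_add, vderiv_mlieBracket (hX.1 x) (hY.1 x) hf,
    vderiv_mlieBracket (hX.2 x) (hY.2 x) hf, vderiv_mlieBracket (hX.1 x) (hY.2 x) hf,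
    vderiv_mlieBracket (hX.2 x) (hY.1 x) hf, key hX hfX, key hX hfX, key hY hfY, key hY hfY,
    smul_eq_mul]
  linear_combination
    (vderiv (fun y => vderiv f y (imT (X y))) x (imT (Y x)) -
      vderiv (fun y => vderiv f y (imT (Y y))) x (imT (X x))) * (Complex.I_mul_I)

end SmoothFields

/-! ### The distribution is a Kähler polarization -/

section Polarization

variable {E : Type*} [NormedAddCommGroup E] [NormedSpace ℝ E]
  {M : Type*} [TopologicalSpace M] [ChartedSpace E M] [IsManifold 𝓘(ℝ, E) ∞ M]
  {H : Type*} [NormedAddCommGroup H] [InnerProductSpace ℂ H] {K : M → ℙ ℂ H} {N : ℕ}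

/-- The vectors spanning the distribution are by definition values of global smooth sections, and
linear combinations preserve this. -/
lemma exists_isSection_distribution {x : M} {Z : CTangent E x}
    (hZ : Z ∈ distribution (E := E) K x) :
    ∃ X, IsSection (distribution (E := E) K) X ∧ X x = Z := by
  induction hZ using Submodule.span_induction with
  | mem Z hZ =>
    obtain ⟨X, hX, hX', rfl⟩ := hZ
    exact ⟨X, ⟨hX, fun y => Submodule.subset_span ⟨X, hX, hX', rfl⟩⟩, rfl⟩
  | zero => exact ⟨fun _ => 0, ⟨SmoothField.zero, fun y => zero_mem _⟩, rfl⟩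
  | add Z W _ _ hZ hW =>
    obtain ⟨X, hX, rfl⟩ := hZ
    obtain ⟨Y, hY, rfl⟩ := hW
    exact ⟨_, ⟨hX.1.add_smul hY.1 1, fun y =>
      add_mem (hX.2 y) (Submodule.smul_mem _ _ (hY.2 y))⟩, by simp⟩
  | smul a Z _ hZ =>
    obtain ⟨X, hX, rfl⟩ := hZ
    exact ⟨_, ⟨SmoothField.zero.add_smul hX.1 a, fun y =>
      add_mem (zero_mem _) (Submodule.smul_mem _ _ (hX.2 y))⟩, by simp⟩

/-- At each point the distribution is the common kernel of N differentials of multipliers. Sections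
annihilate these functions everywhere, hence so does their bracket. -/
lemma IsCoherentStateMap.isSection_bracket [FiniteDimensional ℝ E]
    (hK : IsCoherentStateMap (E := E) K N) {X Y : (x : M) → CTangent E x}
    (hX : IsSection (distribution K) X) (hY : IsSection (distribution K) Y) :
    IsSection (distribution K) (bracket X Y) := by
  have : CompleteSpace E := FiniteDimensional.complete ℝ E
  refine ⟨hX.1.bracket hY.1, fun x => ?_⟩
  obtain ⟨U, -, hx, l, hl, hli⟩ := hK.coordinates x
  rw [hK.mem_distribution_iff_of_linearIndependent hl (hli x hx)]
  exact fun i => extC_vderiv_bracket_eq_zero hX.1 hY.1 (hl i).1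
    (fun y => hK.extC_multiplier_eq_zero (hl i) (hX.2 y))
    (fun y => hK.extC_multiplier_eq_zero (hl i) (hY.2 y)) x

/-- The distribution of a coherent state map is a Kähler polarization. -/
lemma IsCoherentStateMap.isKahlerPolarization [FiniteDimensional ℝ E]
    (hK : IsCoherentStateMap (E := E) K N) :
    IsKahlerPolarization N (curvForm (E := E) K) (distribution K) where
  rank_eq := hK.maximal
  smooth _ _ hZ := exists_isSection_distribution hZ
  isotropic _ _ hZ _ hW := hK.isotropic hZ hW
  involutive _ _ := hK.isSection_bracket
  transversal _ _ := hK.transversal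
  positive _ _ := hK.positive

end Polarization

/-! ### The Kähler structure and the Kähler immersion -/

section Kahler

open Filter

variable {E : Type*} [NormedAddCommGroup E] [NormedSpace ℝ E] [FiniteDimensional ℝ E]
  {M : Type*} [TopologicalSpace M] [ChartedSpace E M] [IsManifold 𝓘(ℝ, E) ∞ M]
  {H : Type*} [NormedAddCommGroup H] [InnerProductSpace ℂ H] {K : M → ℙ ℂ H} {N : ℕ}
  {U : Set M} {s : (x : M) → (K x).submodule} {x : M}

/-- The map to `ℂ ^ n` whose components are the complex conjugates of the given functions. -/
def conjCoordinates {n : ℕ} (l : Fin n → M → ℂ) (y : M) : EuclideanSpace ℂ (Fin n) :=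
  WithLp.toLp 2 fun i => starRingEnd ℂ (l i y)

omit [FiniteDimensional ℝ E] [IsManifold 𝓘(ℝ, E) ∞ M] in
lemma contMDiff_conjCoordinates {n : ℕ} {l : Fin n → M → ℂ}
    (hl : ∀ i, ContMDiff 𝓘(ℝ, E) 𝓘(ℝ, ℂ) ∞ (l i)) :
    ContMDiff 𝓘(ℝ, E) 𝓘(ℝ, EuclideanSpace ℂ (Fin n)) ∞ (conjCoordinates l) := by
  have h : ContMDiff 𝓘(ℝ, E) 𝓘(ℝ, Fin n → ℂ) ∞ (fun y i => Complex.conjCLE (l i y)) :=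
    contMDiff_pi_space.2 fun i => Complex.conjCLE.contDiff.contMDiff.comp (hl i)
  exact ((EuclideanSpace.equiv (Fin n) ℂ).symm.toContinuousLinearMap.restrictScalars
    ℝ).contDiff.contMDiff.comp h

omit [FiniteDimensional ℝ E] [IsManifold 𝓘(ℝ, E) ∞ M] in
lemma vderiv_conjCoordinates {n : ℕ} {l : Fin n → M → ℂ}
    (hl : ∀ i, ContMDiff 𝓘(ℝ, E) 𝓘(ℝ, ℂ) ∞ (l i)) (x : M) (u : TangentSpace 𝓘(ℝ, E) x) (i : Fin n) :
    (vderiv (conjCoordinates l) x u) i = starRingEnd ℂ (vderiv (l i) x u) := by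
  have h₁ := vderiv_clm_comp ((EuclideanSpace.proj i : EuclideanSpace ℂ (Fin n) →L[ℂ] ℂ).restrictScalars ℝ)
    ((contMDiff_conjCoordinates hl).mdifferentiableAt (by simp) (x := x)) u
  have h₂ := vderiv_clm_comp (Complex.conjCLE : ℂ →L[ℝ] ℂ)
    ((hl i).mdifferentiableAt (by simp) (x := x)) u
  exact h₁.symm.trans h₂

namespace IsCoherentStateMap

variable (hK : IsCoherentStateMap (E := E) K N)
include hK

/-- The conjugates of independent multipliers form holomorphic charts. -/
lemma exists_isHolChart (x : M) : ∃ e : OpenPartialHomeomorph M (EuclideanSpace ℂ (Fin N)),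
    x ∈ e.source ∧ IsHolChart hK.J e := by
  obtain ⟨U, hU, hx, l, hl, hli⟩ := hK.coordinates x
  have hl' (i : Fin N) : ContMDiff 𝓘(ℝ, E) 𝓘(ℝ, ℂ) ∞ (l i) := (hl i).1
  have hsm := contMDiff_conjCoordinates hl'
  have hinj : ∀ y ∈ U, ∀ u : TangentSpace 𝓘(ℝ, E) y, vderiv (conjCoordinates l) y u = 0 → u = 0 := by
    intro y hy u hu
    have h₀ (i : Fin N) : vderiv (l i) y u = 0 := by
      have h := vderiv_conjCoordinates hl' y u i
      rw [hu] at h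
      exact (map_eq_zero (starRingEnd ℂ)).1 h.symm
    -- A real vector killed by all the differentials lies in P and equals its own conjugate, so
    -- transversality applies.
    have hm : mkT u 0 ∈ distribution (E := E) K y :=
      (hK.mem_distribution_iff_of_linearIndependent hl (hli y hy) _).2 fun i => by simp [h₀]
    have h₁ := hK.transversal hm (by simpa [conjT] using hm)
    simpa using congrArg reT h₁
  have hfin : finrank ℝ E = finrank ℝ (EuclideanSpace ℂ (Fin N)) := by
    rw [hK.dim_eq, finrank_real_of_complex, finrank_euclideanSpace_fin]
  obtain ⟨e, hxe, heU, hef, hes⟩ := exists_openPartialHomeomorph hsm hU hinj hfin hx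
  refine ⟨e, hxe, hsm.contMDiffOn.congr hef, hes, fun y hy u => ?_⟩
  have h : vderiv (E := E) e y = vderiv (conjCoordinates l) y := by
    apply Filter.EventuallyEq.mfderiv_eq
    filter_upwards [e.open_source.mem_nhds hy] with t ht using hef ht
  -- The multipliers satisfy dλ(Ju) = -i dλ(u); conjugation turns the factor into i.
  rw [h]
  ext i
  rw [PiLp.smul_apply, vderiv_conjCoordinates hl', vderiv_conjCoordinates hl',
    hK.vderiv_multiplier_J (hl i)]
  simp

/-- The atlas given by the complex conjugates of the multipliers. -/
@[reducible]
def charts : ChartedSpace (EuclideanSpace ℂ (Fin N)) M where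
  atlas := range fun x => (hK.exists_isHolChart x).choose
  chartAt x := (hK.exists_isHolChart x).choose
  mem_chart_source x := (hK.exists_isHolChart x).choose_spec.1
  chart_mem_atlas x := mem_range_self x

lemma isHolChart {e : OpenPartialHomeomorph M (EuclideanSpace ℂ (Fin N))}
    (he : e ∈ hK.charts.atlas) : IsHolChart hK.J e := by
  obtain ⟨x, rfl⟩ := he
  exact (hK.exists_isHolChart x).choose_spec.2

/-- The Kähler structure given by a coherent state map. -/
def kahlerStructure : KahlerStructure N E M where
  charts := hK.charts
  holomorphic_charts := by
    let := hK.charts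
    refine isManifold_of_contDiffOn _ _ _ fun e e' he he' => ?_
    have h := (hK.isHolChart he).contDiffOn_transition (hK.isHolChart he')
    simpa using h
  smooth_charts e he := ⟨(hK.isHolChart he).smooth, (hK.isHolChart he).smooth_symm⟩
  J := hK.J
  deriv_J e he := (hK.isHolChart he).deriv_J
  g := hK.metric
  hermitian x u v := by
    obtain ⟨U, s, hs, hx⟩ := hK.smooth x
    rw [hK.metric_apply hs hx, hK.metric_apply hs hx, hK.frameHerm_J_J hs hx]
  form x := Complex.reCLM.compContinuousAlternatingMap (curvForm K x)
  form_apply x u v := by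
    obtain ⟨U, s, hs, hx⟩ := hK.smooth x
    rw [hK.metric_apply hs hx, hK.frameHerm_J_right hs hx]
    change (curvForm K x ![u, v]).re = _
    rw [hs.curvForm_eq hx, ← frameHerm_conj s x u v]
    simp
    ring
  closed x := by
    obtain ⟨U, s, hs, hx⟩ := hK.smooth x
    refine hs.form_d_eq_zero hx fun y u v => ?_
    change ((curvForm K y ![u, v]).re : ℂ) = _
    rw [hK.curvForm_eq_hermForm, Complex.ofReal_re]

lemma kahlerStructure_form (x : M) (u v : TangentSpace 𝓘(ℝ, E) x) :
    (hK.kahlerStructure.form x ![u, v] : ℂ) = curvForm K x ![u, v] := by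
  change ((curvForm K x ![u, v]).re : ℂ) = _
  rw [hK.curvForm_eq_hermForm, Complex.ofReal_re]

omit [FiniteDimensional ℝ E] [IsManifold 𝓘(ℝ, E) ∞ M] hK in
/-- The frame normalised by its product with a fixed vector. -/
lemma _root_.CoherentState.IsFrame.normalise (hs : IsFrame (E := E) K U s) (v : H) :
    IsFrame (E := E) K {y ∈ U | ⟪v, (s y : H)⟫_ℂ ≠ 0} fun y => (⟪v, (s y : H)⟫_ℂ)⁻¹ • s y where
  isOpen := by
    refine ContinuousOn.isOpen_inter_preimage ?_ hs.isOpen isOpen_compl_singleton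
    exact (innerSL ℂ v).continuous.comp_continuousOn hs.smooth.continuousOn
  smooth y hy := by
    have h₁ : ContMDiffAt 𝓘(ℝ, E) 𝓘(ℝ, ℂ) ∞ (fun y => ⟪v, (s y : H)⟫_ℂ) y :=
      ((innerSL ℂ v).restrictScalars ℝ).contDiff.contDiffAt.contMDiffAt.comp y
        (hs.contMDiffAt hy.1)
    have h₂ : ContDiffAt ℝ ∞ (fun p : ℂ × H => p.1⁻¹ • p.2) (⟪v, (s y : H)⟫_ℂ, (s y : H)) :=
      (contDiffAt_fst.inv hy.2).smul contDiffAt_snd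
    exact (h₂.contMDiffAt.comp y (h₁.prodMk_space (hs.contMDiffAt hy.1))).contMDiffWithinAt
  ne_zero y hy := smul_ne_zero (inv_ne_zero hy.2) (hs.ne_zero y hy.1)

/-- Since D commutes with the complex structures, ds(Ju) - i ds(u) is a multiple of s.
Differentiating ⟨v|s⟩ = 1 shows that v is orthogonal to all ds(w), so the coefficient vanishes. -/
lemma vderiv_normalise_J (hs : IsFrame (E := E) K U s) {v : H} (hv : ∀ y ∈ U, ⟪v, (s y : H)⟫_ℂ = 1)
    (hx : x ∈ U) (u : TangentSpace 𝓘(ℝ, E) x) :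
    vderiv (fun y => (s y : H)) x (hK.J x u) =
      Complex.I • vderiv (E := E) (fun y => (s y : H)) x u := by
  have h₀ (w : TangentSpace 𝓘(ℝ, E) x) : ⟪v, vderiv (fun y => (s y : H)) x w⟫_ℂ = 0 := by
    have h := vderiv_clm_comp ((innerSL ℂ v).restrictScalars ℝ) (hs.mdifferentiableAt hx) w
    have h' : vderiv (E := E) (fun y => ((innerSL ℂ v).restrictScalars ℝ) (s y : H)) x =
        vderiv (fun _ => (1 : ℂ)) x := by
      apply Filter.EventuallyEq.mfderiv_eq
      filter_upwards [hs.isOpen.mem_nhds hx] with y hy using hv y hy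
    rw [h'] at h
    refine h.symm.trans ?_
    rw [vderiv, mfderiv_const]
    rfl
  set a := vderiv (fun y => (s y : H)) x (hK.J x u) with ha
  set b := vderiv (E := E) (fun y => (s y : H)) x u with hb
  have h₁ : horiz (s x : H) (a - Complex.I • b) = 0 := by
    have := hK.hderiv_J hs hx u
    rw [hderiv_apply, hderiv_apply] at this
    rw [map_sub, map_smul, sub_eq_zero]
    exact this
  rw [horiz_apply, sub_eq_zero] at h₁
  have h₂ : ⟪v, a - Complex.I • b⟫_ℂ = 0 := by
    rw [inner_sub_right, inner_smul_right, h₀, h₀, mul_zero, sub_zero]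
  rw [h₁, inner_smul_right, hv x hx, mul_one] at h₂
  rw [h₂, zero_smul, sub_eq_zero] at h₁
  exact h₁

/-- Functions with complex linear differential are holomorphic for the Kähler structure. -/
lemma mdifferentiableAt_complex {f : M → H} (hf : MDifferentiableAt 𝓘(ℝ, E) 𝓘(ℝ, H) f x)
    (h : ∀ u, vderiv f x (hK.J x u) = Complex.I • vderiv (E := E) f x u) :
    letI := hK.charts
    MDifferentiableAt 𝓘(ℂ, EuclideanSpace ℂ (Fin N)) 𝓘(ℂ, H) f x := by
  let e := hK.charts.chartAt x
  have he : IsHolChart hK.J e := hK.isHolChart (hK.charts.chart_mem_atlas x)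
  have hx : x ∈ e.source := hK.charts.mem_chart_source x
  have hex : e.symm (e x) = x := e.left_inv hx
  obtain ⟨h₁, h₂⟩ := he.fderiv_I_smul (f := f) (e.map_source hx) (by rwa [hex]) (by rwa [hex])
  let := hK.charts
  refine (mdifferentiableAt_iff _ _).2 ⟨hf.continuousAt, ?_⟩
  exact (differentiableAt_complex h₁ h₂).differentiableWithinAt

/-- A coherent state map is a Kähler immersion. -/
lemma isKahlerImmersion : IsKahlerImmersion K hK.kahlerStructure where
  holomorphic x := by
    obtain ⟨U, s, hs, hx⟩ := hK.smooth x
    -- With v = s x the normalising factor is nonzero at x, so x stays in the domain.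
    have ht := hs.normalise (s x : H)
    refine ⟨_, _, ht, ⟨hx, inner_self_ne (hs.coe_ne_zero hx)⟩, fun y hy => ?_⟩
    have h := hK.mdifferentiableAt_complex (ht.mdifferentiableAt hy)
      (hK.vderiv_normalise_J ht (v := (s x : H)) (fun z hz => ?_) hy)
    · let := hK.charts
      exact MDifferentiableAt.mdifferentiableWithinAt h
    · rw [Submodule.coe_smul, inner_smul_right, inv_mul_cancel₀ hz.2]
  immersion x := by
    obtain ⟨U, s, hs, hx⟩ := hK.smooth x
    refine projDeriv_injective_iff hs hx fun u hu => hK.hderiv_injective hs hx ?_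
    rw [hu, map_zero]
  metric x u v := by
    obtain ⟨U, s, hs, hx⟩ := hK.smooth x
    rw [fsMetric, hs.fsHerm_projDeriv hx]
    exact (hK.metric_apply hs hx u v).symm
  form x u v := by
    obtain ⟨U, s, hs, hx⟩ := hK.smooth x
    rw [fsForm, hs.fsHerm_projDeriv hx, hs.fsHerm_projDeriv hx, hK.kahlerStructure_form,
      hs.curvForm_eq hx]

lemma distribution_eq_typeOneZero (x : M) :
    (distribution (E := E) K x : Set (CTangent E x)) = hK.kahlerStructure.typeOneZero x := by
  ext Z
  rw [SetLike.mem_coe, hK.mem_distribution_iff]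
  constructor
  · intro h
    exact ⟨reT Z, by rw [← mkT_reT_imT Z, h]; simp; rfl⟩
  · rintro ⟨u, rfl⟩
    rw [reT_mkT, imT_mkT]
    rfl

end IsCoherentStateMap

end Kahler

end CoherentState

end

theorem proposition2p2 {N : ℕ}
    {E : Type*} [NormedAddCommGroup E] [NormedSpace ℝ E] [FiniteDimensional ℝ E]
    {M : Type*} [TopologicalSpace M] [T2Space M] [SecondCountableTopology M]
    [ChartedSpace E M] [IsManifold 𝓘(ℝ, E) ∞ M]
    {H : Type*} [NormedAddCommGroup H] [InnerProductSpace ℂ H] [CompleteSpace H]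
    [TopologicalSpace.SeparableSpace H]
    (K : M → ℙ ℂ H) (hK : IsCoherentStateMap (E := E) K N) :
    (∃ S : KahlerStructure N E M,
      (∀ x, ∀ u v : TangentSpace 𝓘(ℝ, E) x, curvForm K x ![u, v] = (S.form x ![u, v] : ℂ)) ∧
      IsKahlerImmersion K S ∧
      ∀ x, (distribution (E := E) K x : Set (CTangent E x)) = S.typeOneZero x) ∧
    IsKahlerPolarization N (curvForm (E := E) K) (distribution K) ∧
    (∀ l ∈ multipliers (E := E) K, ∃! X, IsHamiltonian (curvForm (E := E) K) l X) ∧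
    ∀ x, distribution (E := E) K x = Submodule.span ℂ
      {Z | ∃ l ∈ multipliers (E := E) K, ∃ X, IsHamiltonian (curvForm K) l X ∧ X x = Z} := by
  refine ⟨⟨hK.kahlerStructure, fun x u v => (hK.kahlerStructure_form x u v).symm,
    hK.isKahlerImmersion, hK.distribution_eq_typeOneZero⟩, hK.isKahlerPolarization,
    fun l hl => hK.existsUnique_isHamiltonian hl.1, hK.distribution_eq_span_hamiltonian⟩
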